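/- Let $(\Omega,\mathcal F,\mathbb P)$ be a probability space. For every integer $n\ge 1$, let $\mathcal G_n\subseteq\mathcal F$ be a sub-$\sigma$-algebra, let $A_n=(a_{ij,n})_{i,j=1}^n$ be a $\mathcal G_n$-measurable random real symmetric $n\times n$ matrix with $A_n(\omega)\neq 0$ for all $\omega\in\Omega$, and let $Z_{1,n},\dots,Z_{n,n}$ be real random variables that are conditionally independent given $\mathcal G_n$ and satisfy, almost surely and for all $i\le n$, $$\mathbb E[Z_{i,n}\mid\mathcal G_n]=0,\qquad \mathbb E[Z_{i,n}^2\mid\mathcal G_n]=1,\qquad \mathbb E[|Z_{i,n}|^4\mid\mathcal G_n]<\infty .$$ Here a conditional expectation given $\mathcal G_n$ is a $[0,\infty]$-valued random variable for a nonnegative random variable, and $\mathbb E[X\mid\mathcal G_n]=\mathbb E[X^+\mid\mathcal G_n]-\mathbb E[X^-\mid\mathcal G_n]$ for a real random variable $X$ with $\mathbb E[|X|\mid\mathcal G_n]<\infty$ almost surely; $X$ itself need not be integrable. For a real matrix $M$ let $\|M\|_S=(\lambda_{\max}(M'M))^{1/2}$ be the spectral norm and $\|M\|_F=(\operatorname{tr}(M'M))^{1/2}$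 the Frobenius norm. Assume that, in probability as $n\to\infty$, $$\frac{\|A_n\|_S^2}{\|A_n\|_F^2}\,\max_{1\le j\le n}\mathbb E[Z_{j,n}^4\mid\mathcal G_n]\to 0,$$ $$\frac{\max_{1\le j\le n}(A_n^2)_{jj}}{\|A_n\|_F^2}\Bigl(\max_{1\le j\le n}\mathbb E[Z_{j,n}^4\mid\mathcal G_n]\Bigr)^2\to 0,$$ $$\sum_{j=1}^n\frac{a_{jj,n}^2\,\mathbb E[Z_{j,n}^4\mid\mathcal G_n]}{\|A_n\|_F^2}\to 0 .$$ Then, with $Z_n=(Z_{1,n},\dots,Z_{n,n})'$, we have $\mathbb E[|Z_n'A_nZ_n|\mid\mathcal G_n]<\infty$ almost surely for every $n\ge1$, and $$\frac{Z_n'A_nZ_n-\mathbb E[Z_n'A_nZ_n\mid\mathcal G_n]}{\sqrt2\,\|A_n\|_F}$$ converges in distribution to $\mathcal N(0,1)$ as $n\to\infty$. -/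

import Mathlib

open MeasureTheory ProbabilityTheory Filter
open scoped Matrix ENNReal

/-- The spectral norm `‖A‖_S` of a real square matrix: its operator norm with respect to the
Euclidean norm, i.e. the square root of the largest eigenvalue of `Aᵀ A`. -/
noncomputable def spectralNormMat {n : ℕ} (A : Matrix (Fin n) (Fin n) ℝ) : ℝ :=
  ‖Matrix.toEuclideanCLM (n := Fin n) (𝕜 := ℝ) A‖

/-- The Frobenius norm `‖A‖_F = (tr (Aᵀ A))^{1/2}`. -/
noncomputable def frobeniusNormMat {n : ℕ} (A : Matrix (Fin n) (Fin n) ℝ) : ℝ :=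
  √((Aᵀ * A).trace)

/-- Conditional independence, given a sub-σ-algebra `G`, of a family of real random variables, on
an arbitrary probability space: conditional probabilities of finite intersections of events
`{X i ∈ B i}` factorize almost surely. (Mathlib's `iCondIndepFun` is restricted to standard Borel
spaces, where the two notions agree for measurable random variables.) -/
def CondIndepGiven {Ω ι : Type*} {mΩ : MeasurableSpace Ω} (P : Measure Ω) (G : MeasurableSpace Ω)
    (X : ι → Ω → ℝ) : Prop :=
  ∀ (S : Finset ι) (B : ι → Set ℝ), (∀ i ∈ S, MeasurableSet (B i)) →
    P⟦⋂ i ∈ S, X i ⁻¹' B i | G⟧ =ᵐ[P] ∏ i ∈ S, P⟦X i ⁻¹' B i | G⟧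

/-- The conditional expectation `E[|X| | G]`, with values in `[0, ∞]`. It is defined for every
random variable `X`, integrable or not. -/
noncomputable def condAbsMoment {Ω : Type*} {mΩ : MeasurableSpace Ω} (P : Measure Ω)
    (G : MeasurableSpace Ω) (X : Ω → ℝ) : Ω → ℝ≥0∞ :=
  P⁻[fun ω => ENNReal.ofReal |X ω| | G]

/-- The conditional expectation `E[X | G] = E[X⁺ | G] - E[X⁻ | G]` of a real random variable whose
conditional absolute moment `E[|X| | G]` is almost surely finite. In contrast to `P[X | G]`, the
variable `X` need not be integrable; for integrable `X` the two agree almost surely. -/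
noncomputable def condExpExt {Ω : Type*} {mΩ : MeasurableSpace Ω} (P : Measure Ω)
    (G : MeasurableSpace Ω) (X : Ω → ℝ) : Ω → ℝ := fun ω =>
  (P⁻[fun ω' => ENNReal.ofReal (X ω') | G] ω).toReal -
    (P⁻[fun ω' => ENNReal.ofReal (-X ω') | G] ω).toReal

/-- The quadratic form `z' A z`. -/
def quadForm {n : ℕ} (A : Matrix (Fin n) (Fin n) ℝ) (z : Fin n → ℝ) : ℝ :=
  z ⬝ᵥ (A *ᵥ z)

/-!
The proof conditions on `G n` and reduces to a deterministic, quantitative statement.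

Let `κ` be the regular conditional distribution of `(Z 1, …, Z n)` given `G n`; it exists because
the vector takes values in the standard Borel space `ℝⁿ`, and no assumption on `Ω` is needed. For
almost every `ω`, the coordinates are independent under `κ ω`, standardized and with finite fourth
moments (`ae_isStandardIndep_condDistrib`), while the coefficient matrix is constant. The extended
conditional expectations are integrals against `κ` (`condExpExt_ae_eq_integral_condDistrib`), so the
conditional mean of the quadratic form is the trace of `A`. Hence the characteristic function of the
normalized form is the mean over `ω` of the characteristic functions under `κ ω`. Those are bounded
by `1` and are close to `exp (-t² / 2)` as soon as the three ratios of the hypotheses are small at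
`ω`, which happens with probability tending to one (`enorm_integral_exp_quadForm_sub_le`); Lévy's
continuity theorem finishes the proof.

For independent standardized `X` with fourth moments at most `M` and constant coefficients, the
diagonal part of the form has small variance by the third ratio. The normalized off-diagonal part is
`Q = ∑ i j, B i j X i X j = 1/2 ∑ j, X j S j`, where `S j = 2 ∑ i, B i j X i` is the partial
derivative of `Q` in the `j`-th direction and is independent of `X j`, as is `Q - X j S j`. A Taylor
expansion in `X j` gives (`norm_integral_mul_exp_sub_le`)
`E[X j S j exp (i t Q)] = i t E[(S j)² exp (i t Q)] + O(t² (E|X j S j|³ + E|X j| |S j|³))`.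
Summing over `j`, the characteristic function `φ` of `Q` satisfies
`φ' t = -t E[V exp (i t Q)] + error` with `V = 1/2 ∑ j, (S j)²`. The error is small by the second
ratio. The variable `V` is the quadratic form of `2 B²`; its mean is about `1`, and its variance is
at most a multiple of `‖B²‖_F² + M ∑ j, ((B²) j j)²`, which the first two ratios control
(`IsStandardIndep.integral_abs_sum_sq_sub_one_le`). So `φ' = -t φ` up to a small error, which forces
`φ t` to be close to `exp (-t² / 2)` (`norm_sub_exp_neg_sq_div_two_le`).
-/

/-! ### Moments of linear and quadratic forms in independent variables -/

instance holderTriple_four_four_two : ENNReal.HolderTriple 4 4 2 where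
  inv_add_inv_eq_inv := by
    rw [← two_mul, show (4 : ℝ≥0∞) = 2 * 2 by norm_num,
      ENNReal.mul_inv (by simp) (by simp), ← mul_assoc, ENNReal.mul_inv_cancel (by simp) (by simp),
      one_mul]

section Pair

variable {E : Type*} {mE : MeasurableSpace E} {μ : Measure E}

lemma MeasureTheory.MemLp.integrable_pow_four {f : E → ℝ} (hf : MemLp f 4 μ) :
    Integrable (fun ω => f ω ^ 4) μ := by
  have h := hf.integrable_norm_pow (p := 4) (by norm_num)
  refine h.congr (ae_of_all _ fun ω => ?_)
  simp [Real.norm_eq_abs, Even.pow_abs (by decide : Even 4)]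

lemma MeasureTheory.MemLp.mul_four {f g : E → ℝ} (hf : MemLp f 4 μ) (hg : MemLp g 4 μ) :
    MemLp (fun ω => f ω * g ω) 2 μ := hg.mul' hf

lemma MeasureTheory.MemLp.integrable_mul_two {f g : E → ℝ} (hf : MemLp f 2 μ) (hg : MemLp g 2 μ) :
    Integrable (fun ω => f ω * g ω) μ := hf.integrable_mul hg

lemma ProbabilityTheory.IndepFun.integral_comp_mul_comp_of_measurable {𝓧 𝓨 : Type*}
    [MeasurableSpace 𝓧] [MeasurableSpace 𝓨] {x : E → 𝓧} {y : E → 𝓨}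
    (h : IndepFun x y μ) (hx : Measurable x) (hy : Measurable y) {f : 𝓧 → ℝ} {g : 𝓨 → ℝ}
    (hf : Measurable f) (hg : Measurable g) :
    ∫ ω, f (x ω) * g (y ω) ∂μ = (∫ ω, f (x ω) ∂μ) * ∫ ω, g (y ω) ∂μ :=
  h.integral_fun_comp_mul_comp hx.aemeasurable hy.aemeasurable hf.aestronglyMeasurable
    hg.aestronglyMeasurable

lemma integral_add_mul_pow_four_of_indepFun {x W : E → ℝ} (h : IndepFun x W μ)
    (hxm : Measurable x) (hWm : Measurable W) (hx : MemLp x 4 μ) (hW : MemLp W 4 μ)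
    (hx1 : ∫ ω, x ω ∂μ = 0) (hx2 : ∫ ω, x ω ^ 2 ∂μ = 1) (hW1 : ∫ ω, W ω ∂μ = 0) (c : ℝ) :
    ∫ ω, (c * x ω + W ω) ^ 4 ∂μ =
      ∫ ω, W ω ^ 4 ∂μ + 6 * c ^ 2 * ∫ ω, W ω ^ 2 ∂μ + c ^ 4 * ∫ ω, x ω ^ 4 ∂μ := by
  have i0 := hW.integrable_pow_four
  have i4 := hx.integrable_pow_four
  have i1 : Integrable (fun ω => x ω * W ω ^ 3) μ := by
    refine ((hx.mul_four hW).integrable_mul_two (hW.mul_four hW)).congr (ae_of_all _ fun ω => ?_)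
    simp only; ring
  have i2 : Integrable (fun ω => x ω ^ 2 * W ω ^ 2) μ := by
    refine ((hx.mul_four hW).integrable_mul_two (hx.mul_four hW)).congr (ae_of_all _ fun ω => ?_)
    simp only; ring
  have i3 : Integrable (fun ω => x ω ^ 3 * W ω) μ := by
    refine ((hx.mul_four hx).integrable_mul_two (hx.mul_four hW)).congr (ae_of_all _ fun ω => ?_)
    simp only; ring
  have e : ∀ ω, (c * x ω + W ω) ^ 4 = W ω ^ 4 + 4 * c * (x ω * W ω ^ 3)
      + 6 * c ^ 2 * (x ω ^ 2 * W ω ^ 2) + 4 * c ^ 3 * (x ω ^ 3 * W ω) + c ^ 4 * x ω ^ 4 := by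
    intro ω; ring
  simp_rw [e]
  rw [integral_add (by fun_prop) (by fun_prop), integral_add (by fun_prop) (by fun_prop),
    integral_add (by fun_prop) (by fun_prop), integral_add (by fun_prop) (by fun_prop)]
  simp_rw [integral_const_mul]
  rw [h.integral_comp_mul_comp_of_measurable hxm hWm (f := fun a => a) (g := fun b => b ^ 3)
      (by fun_prop) (by fun_prop),
    h.integral_comp_mul_comp_of_measurable hxm hWm (f := fun a => a ^ 2) (g := fun b => b ^ 2)
      (by fun_prop) (by fun_prop),
    h.integral_comp_mul_comp_of_measurable hxm hWm (f := fun a => a ^ 3) (g := fun b => b)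
      (by fun_prop) (by fun_prop), hx1, hx2, hW1]
  ring

lemma integral_add_mul_sq_of_indepFun {x W : E → ℝ} (h : IndepFun x W μ)
    (hxm : Measurable x) (hWm : Measurable W) (hx : MemLp x 2 μ) (hW : MemLp W 2 μ)
    (hx1 : ∫ ω, x ω ∂μ = 0) (hx2 : ∫ ω, x ω ^ 2 ∂μ = 1) (c : ℝ) :
    ∫ ω, (c * x ω + W ω) ^ 2 ∂μ = ∫ ω, W ω ^ 2 ∂μ + c ^ 2 := by
  have i0 := hW.integrable_sq
  have i2 := hx.integrable_sq
  have i1 := hx.integrable_mul_two hW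
  have e : ∀ ω, (c * x ω + W ω) ^ 2 = W ω ^ 2 + 2 * c * (x ω * W ω) + c ^ 2 * x ω ^ 2 := by
    intro ω; ring
  simp_rw [e]
  rw [integral_add (by fun_prop) (by fun_prop), integral_add (by fun_prop) (by fun_prop)]
  simp_rw [integral_const_mul]
  rw [h.integral_comp_mul_comp_of_measurable hxm hWm (f := fun a => a) (g := fun b => b)
      (by fun_prop) (by fun_prop), hx1, hx2]
  ring

variable [IsProbabilityMeasure μ]

/-- The effect of one new variable `x` on the second moment of a centred quadratic form `U`: the
coefficient of `x` is a linear form `2 W` in the old variables, that of `x ^ 2` is `c`. -/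
lemma integral_sq_quadratic_step {x W U : E → ℝ} (h : IndepFun x (fun ω => (W ω, U ω)) μ)
    (hxm : Measurable x) (hWm : Measurable W) (hUm : Measurable U)
    (hx : MemLp x 4 μ) (hW : MemLp W 4 μ) (hU : MemLp U 2 μ)
    (hx1 : ∫ ω, x ω ∂μ = 0) (hx2 : ∫ ω, x ω ^ 2 ∂μ = 1)
    (hW1 : ∫ ω, W ω ∂μ = 0) (c : ℝ) :
    ∫ ω, (U ω + 2 * (x ω * W ω) + c * (x ω ^ 2 - 1)) ^ 2 ∂μ =
      ∫ ω, U ω ^ 2 ∂μ + 4 * ∫ ω, W ω ^ 2 ∂μ + c ^ 2 * (∫ ω, x ω ^ 4 ∂μ - 1) := by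
  have hWU : Measurable (fun ω => (W ω, U ω)) := hWm.prodMk hUm
  have hx2' : MemLp x 2 μ := hx.mono_exponent (by norm_num)
  have hW2' : MemLp W 2 μ := hW.mono_exponent (by norm_num)
  have hy : MemLp (fun ω => x ω ^ 2 - 1) 2 μ := by
    simp_rw [sq]
    exact (hx.mul_four hx).sub (memLp_const 1)
  have i1 : Integrable (fun ω => U ω ^ 2) μ := hU.integrable_sq
  have i2 : Integrable (fun ω => x ω ^ 2 * W ω ^ 2) μ := by
    refine ((hx.mul_four hW).integrable_mul_two (hx.mul_four hW)).congr (ae_of_all _ fun ω => ?_)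
    simp only; ring
  have i3 : Integrable (fun ω => (x ω ^ 2 - 1) ^ 2) μ := hy.integrable_sq
  have i4 : Integrable (fun ω => x ω * (W ω * U ω)) μ := by
    refine ((hx.mul_four hW).integrable_mul_two hU).congr (ae_of_all _ fun ω => ?_)
    simp only; ring
  have i5 : Integrable (fun ω => (x ω ^ 2 - 1) * U ω) μ := hy.integrable_mul_two hU
  have i6 : Integrable (fun ω => x ω * (x ω ^ 2 - 1) * W ω) μ := by
    refine ((hx.mul_four hW).integrable_mul_two hy).congr (ae_of_all _ fun ω => ?_)
    simp only; ring
  have e : ∀ ω, (U ω + 2 * (x ω * W ω) + c * (x ω ^ 2 - 1)) ^ 2 =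
      U ω ^ 2 + 4 * (x ω ^ 2 * W ω ^ 2) + c ^ 2 * (x ω ^ 2 - 1) ^ 2 + 4 * (x ω * (W ω * U ω))
      + 2 * c * ((x ω ^ 2 - 1) * U ω) + 4 * c * (x ω * (x ω ^ 2 - 1) * W ω) := by
    intro ω; ring
  simp_rw [e]
  rw [integral_add (by fun_prop) (by fun_prop), integral_add (by fun_prop) (by fun_prop),
    integral_add (by fun_prop) (by fun_prop), integral_add (by fun_prop) (by fun_prop),
    integral_add (by fun_prop) (by fun_prop)]
  simp_rw [integral_const_mul]
  have ix2 := hx2'.integrable_sq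
  have ix4 := hx.integrable_pow_four
  have hx21 : ∫ ω, (x ω ^ 2 - 1) ∂μ = 0 := by
    rw [integral_sub ix2 (by fun_prop), hx2]; simp
  have hx22 : ∫ ω, (x ω ^ 2 - 1) ^ 2 ∂μ = ∫ ω, x ω ^ 4 ∂μ - 1 := by
    have e : ∀ ω, (x ω ^ 2 - 1) ^ 2 = x ω ^ 4 - 2 * x ω ^ 2 + 1 := by intro ω; ring
    simp_rw [e]
    rw [integral_add (by fun_prop) (by fun_prop), integral_sub (by fun_prop) (by fun_prop),
      integral_const_mul, hx2]
    simp; ring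
  rw [h.integral_comp_mul_comp_of_measurable hxm hWU (f := fun a => a) (g := fun b => b.1 * b.2)
      (by fun_prop) (by fun_prop),
    h.integral_comp_mul_comp_of_measurable hxm hWU (f := fun a => a ^ 2) (g := fun b => b.1 ^ 2)
      (by fun_prop) (by fun_prop),
    h.integral_comp_mul_comp_of_measurable hxm hWU (f := fun a => a ^ 2 - 1) (g := fun b => b.2)
      (by fun_prop) (by fun_prop),
    h.integral_comp_mul_comp_of_measurable hxm hWU (f := fun a => a * (a ^ 2 - 1))
      (g := fun b => b.1) (by fun_prop) (by fun_prop), hx1, hx2, hW1, hx21, hx22]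
  ring

end Pair

/-- Independent real random variables with mean zero, variance one and finite fourth moment. -/
structure IsStandardIndep {E ι : Type*} {mE : MeasurableSpace E} (X : ι → E → ℝ)
    (μ : Measure E) : Prop where
  measurable : ∀ i, Measurable (X i)
  indep : iIndepFun X μ
  memLp : ∀ i, MemLp (X i) 4 μ
  integral_eq_zero : ∀ i, ∫ ω, X i ω ∂μ = 0
  integral_sq : ∀ i, ∫ ω, X i ω ^ 2 ∂μ = 1

namespace IsStandardIndep

variable {E ι : Type*} {mE : MeasurableSpace E} {μ : Measure E} {X : ι → E → ℝ}

lemma memLp_linear (hX : IsStandardIndep X μ) (s : Finset ι) (c : ι → ℝ) :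
    MemLp (fun ω => ∑ i ∈ s, c i * X i ω) 4 μ :=
  memLp_finsetSum _ fun i _ => (hX.memLp i).const_mul (c i)

lemma measurable_linear (hX : IsStandardIndep X μ) (s : Finset ι) (c : ι → ℝ) :
    Measurable (fun ω => ∑ i ∈ s, c i * X i ω) := by
  have := hX.measurable
  fun_prop

lemma memLp_quadratic (hX : IsStandardIndep X μ) (s : Finset ι) (C : Matrix ι ι ℝ) :
    MemLp (fun ω => ∑ i ∈ s, ∑ j ∈ s, C i j * (X i ω * X j ω)) 2 μ :=
  memLp_finsetSum _ fun i _ => memLp_finsetSum _ fun j _ =>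
    ((hX.memLp i).mul_four (hX.memLp j)).const_mul _

lemma measurable_quadratic (hX : IsStandardIndep X μ) (s : Finset ι) (C : Matrix ι ι ℝ) :
    Measurable (fun ω => ∑ i ∈ s, ∑ j ∈ s, C i j * (X i ω * X j ω)) := by
  have := hX.measurable
  fun_prop

/-- `X k` is independent of the family that keeps `X i` for `i ∈ s` and is zero elsewhere. -/
lemma indepFun_restrict [DecidableEq ι] (hX : IsStandardIndep X μ) {k : ι} {s : Finset ι}
    (hk : k ∉ s) :
    IndepFun (X k) (fun ω i => if i ∈ s then X i ω else 0) μ := by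
  have h := hX.indep.indepFun_finset {k} s (by simpa using hk) hX.measurable
  have hφ : Measurable (fun f : ({k} : Finset ι) → ℝ => f ⟨k, Finset.mem_singleton_self k⟩) :=
    measurable_pi_apply _
  have hψ : Measurable (fun (f : s → ℝ) (i : ι) => if hi : i ∈ s then f ⟨i, hi⟩ else 0) := by
    refine measurable_pi_lambda _ fun i => ?_
    by_cases hi : i ∈ s
    · simpa only [hi, dite_true] using measurable_pi_apply _
    · simp [hi]
  exact h.comp hφ hψ

lemma indepFun_linear [DecidableEq ι] (hX : IsStandardIndep X μ) {k : ι} {s : Finset ι}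
    (hk : k ∉ s) (c : ι → ℝ) :
    IndepFun (X k) (fun ω => ∑ i ∈ s, c i * X i ω) μ := by
  have h := (hX.indepFun_restrict hk).comp (φ := id) (ψ := fun y => ∑ i ∈ s, c i * y i)
    measurable_id (by fun_prop)
  convert! h using 1
  funext ω
  exact Finset.sum_congr rfl fun i hi => by simp [hi]

variable [IsProbabilityMeasure μ]

lemma integrable (hX : IsStandardIndep X μ) (i : ι) : Integrable (X i) μ :=
  (hX.memLp i).integrable (by norm_num)

/-- The fourth moment of a standardized variable is at least `1`. -/
lemma one_le_integral_pow_four (hX : IsStandardIndep X μ) (i : ι) :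
    1 ≤ ∫ ω, X i ω ^ 4 ∂μ := by
  have i4 := (hX.memLp i).integrable_pow_four
  have i2 : Integrable (fun ω => X i ω ^ 2) μ :=
    ((hX.memLp i).mono_exponent (by norm_num : (2 : ℝ≥0∞) ≤ 4)).integrable_sq
  have h : 0 ≤ ∫ ω, (X i ω ^ 2 - 1) ^ 2 ∂μ := integral_nonneg fun ω => sq_nonneg _
  have e : ∀ ω, (X i ω ^ 2 - 1) ^ 2 = X i ω ^ 4 - 2 * X i ω ^ 2 + 1 := by intro ω; ring
  simp_rw [e] at h
  rw [integral_add (by fun_prop) (by fun_prop), integral_sub (by fun_prop) (by fun_prop),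
    integral_const_mul, hX.integral_sq] at h
  simp at h
  linarith

lemma integral_linear (hX : IsStandardIndep X μ) (s : Finset ι) (c : ι → ℝ) :
    ∫ ω, ∑ i ∈ s, c i * X i ω ∂μ = 0 := by
  rw [integral_finsetSum _ fun i _ => (hX.integrable i).const_mul _]
  simp [integral_const_mul, hX.integral_eq_zero]

lemma integral_quadratic (hX : IsStandardIndep X μ) (s : Finset ι) (C : Matrix ι ι ℝ) :
    ∫ ω, ∑ i ∈ s, ∑ j ∈ s, C i j * (X i ω * X j ω) ∂μ = ∑ i ∈ s, C i i := by
  have hint : ∀ i j, Integrable (fun ω => C i j * (X i ω * X j ω)) μ := fun i j =>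
    (((hX.memLp i).mul_four (hX.memLp j)).integrable (by norm_num)).const_mul _
  rw [integral_finsetSum _ fun i _ => integrable_finsetSum _ fun j _ => hint i j]
  refine Finset.sum_congr rfl fun i hi => ?_
  rw [integral_finsetSum _ fun j _ => hint i j, Finset.sum_eq_single_of_mem i hi]
  · simp_rw [integral_const_mul, ← sq]
    rw [hX.integral_sq, mul_one]
  · intro j _ hj
    rw [integral_const_mul, (hX.indep.indepFun hj.symm).integral_fun_mul_eq_mul_integral
      (hX.measurable i).aestronglyMeasurable (hX.measurable j).aestronglyMeasurable,
      hX.integral_eq_zero]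
    simp

variable [DecidableEq ι]

lemma integral_linear_sq (hX : IsStandardIndep X μ) (s : Finset ι) (c : ι → ℝ) :
    ∫ ω, (∑ i ∈ s, c i * X i ω) ^ 2 ∂μ = ∑ i ∈ s, c i ^ 2 := by
  induction s using Finset.induction_on with
  | empty => simp
  | insert k s hk ih =>
    simp_rw [Finset.sum_insert hk]
    rw [integral_add_mul_sq_of_indepFun (hX.indepFun_linear hk c) (hX.measurable k)
      (hX.measurable_linear s c) ((hX.memLp k).mono_exponent (by norm_num))
      ((hX.memLp_linear s c).mono_exponent (by norm_num)) (hX.integral_eq_zero k)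
      (hX.integral_sq k), ih]
    ring

lemma integral_linear_pow_four_le (hX : IsStandardIndep X μ) {M : ℝ}
    (hM : ∀ i, ∫ ω, X i ω ^ 4 ∂μ ≤ M) (s : Finset ι) (c : ι → ℝ) :
    ∫ ω, (∑ i ∈ s, c i * X i ω) ^ 4 ∂μ ≤ (3 + M) * (∑ i ∈ s, c i ^ 2) ^ 2 := by
  induction s using Finset.induction_on with
  | empty => simp
  | insert k s hk ih =>
    have hM1 : 1 ≤ M := (hX.one_le_integral_pow_four k).trans (hM k)
    simp_rw [Finset.sum_insert hk]
    rw [integral_add_mul_pow_four_of_indepFun (hX.indepFun_linear hk c) (hX.measurable k)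
      (hX.measurable_linear s c) (hX.memLp k) (hX.memLp_linear s c) (hX.integral_eq_zero k)
      (hX.integral_sq k) (hX.integral_linear s c), hX.integral_linear_sq]
    have hs : 0 ≤ ∑ i ∈ s, c i ^ 2 := Finset.sum_nonneg fun i _ => sq_nonneg _
    have h1 : c k ^ 4 * ∫ ω, X k ω ^ 4 ∂μ ≤ c k ^ 4 * M :=
      mul_le_mul_of_nonneg_left (hM k) (by positivity)
    have h2 : 0 ≤ M * (c k ^ 2 * ∑ i ∈ s, c i ^ 2) := by positivity
    have h3 : 0 ≤ c k ^ 4 := by positivity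
    nlinarith

/-- Variance of a quadratic form in independent standardized variables. -/
lemma integral_quadratic_sub_trace_sq (hX : IsStandardIndep X μ) (s : Finset ι)
    {C : Matrix ι ι ℝ} (hC : C.IsSymm) :
    ∫ ω, (∑ i ∈ s, ∑ j ∈ s, C i j * (X i ω * X j ω) - ∑ i ∈ s, C i i) ^ 2 ∂μ =
      2 * ∑ i ∈ s, ∑ j ∈ s, C i j ^ 2 + ∑ i ∈ s, C i i ^ 2 * (∫ ω, X i ω ^ 4 ∂μ - 3) := by
  induction s using Finset.induction_on with
  | empty => simp
  | insert k s hk ih =>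
    have e : ∀ ω, (∑ i ∈ insert k s, ∑ j ∈ insert k s, C i j * (X i ω * X j ω)
          - ∑ i ∈ insert k s, C i i) =
        (∑ i ∈ s, ∑ j ∈ s, C i j * (X i ω * X j ω) - ∑ i ∈ s, C i i)
          + 2 * (X k ω * ∑ i ∈ s, C i k * X i ω) + C k k * (X k ω ^ 2 - 1) := by
      intro ω
      simp_rw [Finset.sum_insert hk, Finset.sum_add_distrib, Finset.mul_sum]
      have : ∀ j, C k j * (X k ω * X j ω) = X k ω * (C j k * X j ω) := by
        intro j; rw [hC.apply j k]; ring
      have h2 : ∀ j, C j k * (X j ω * X k ω) = X k ω * (C j k * X j ω) := by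
        intro j; ring
      simp_rw [this, h2, two_mul, ← Finset.sum_add_distrib, Finset.sum_add_distrib]
      rw [hC.apply k k]
      ring
    simp_rw [e]
    rw [integral_sq_quadratic_step _ (hX.measurable k) (hX.measurable_linear s _)
      ((hX.measurable_quadratic s C).sub_const _) (hX.memLp k) (hX.memLp_linear s _)
      ((hX.memLp_quadratic s C).sub (memLp_const _)) (hX.integral_eq_zero k) (hX.integral_sq k)
      (hX.integral_linear s _), ih, hX.integral_linear_sq]
    · simp_rw [Finset.sum_insert hk, Finset.sum_add_distrib]
      have : ∀ j, C k j ^ 2 = C j k ^ 2 := fun j => by rw [hC.apply j k]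
      simp_rw [this]
      ring
    · have h := (hX.indepFun_restrict hk).comp (φ := id)
        (ψ := fun y => (∑ i ∈ s, C i k * y i,
          ∑ i ∈ s, ∑ j ∈ s, C i j * (y i * y j) - ∑ i ∈ s, C i i)) measurable_id (by fun_prop)
      convert! h using 1
      funext ω
      refine Prod.ext ?_ ?_
      · exact Finset.sum_congr rfl fun i hi => by simp [hi]
      · refine congrArg (· - ∑ i ∈ s, C i i) ?_
        exact Finset.sum_congr rfl fun i hi => Finset.sum_congr rfl fun j hj => by simp [hi, hj]

end IsStandardIndep

/-! ### Characteristic functions of quadratic forms -/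

lemma norm_exp_ofReal_mul_I_sub_one_le (x : ℝ) : ‖Complex.exp (x * Complex.I) - 1‖ ≤ |x| := by
  have := Real.norm_exp_I_mul_ofReal_sub_one_le (x := x)
  rwa [mul_comm, Real.norm_eq_abs] at this

lemma norm_exp_ofReal_mul_I_sub_one_sub_le (x : ℝ) :
    ‖Complex.exp (x * Complex.I) - 1 - x * Complex.I‖ ≤ 2 * x ^ 2 := by
  have hn : ‖(x : ℂ) * Complex.I‖ = |x| := by simp
  rcases le_total |x| 1 with h | h
  · have := Complex.norm_exp_sub_one_sub_id_le (x := x * Complex.I) (by rwa [hn])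
    rw [hn, sq_abs] at this
    nlinarith [sq_nonneg x]
  · calc _ ≤ ‖Complex.exp (x * Complex.I) - 1‖ + ‖(x : ℂ) * Complex.I‖ := norm_sub_le _ _
      _ ≤ |x| + |x| := by rw [hn]; gcongr; exact norm_exp_ofReal_mul_I_sub_one_le x
      _ ≤ 2 * x ^ 2 := by rw [← sq_abs]; nlinarith

/-- A function that nearly solves the differential equation `φ' = -s φ` of the standard Gaussian
characteristic function is close to it. -/
lemma norm_sub_exp_neg_sq_div_two_le {φ φ' : ℝ → ℂ} (hφ : ∀ s, HasDerivAt φ (φ' s) s)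
    (h0 : φ 0 = 1) {K : ℝ} (t : ℝ) (hK : ∀ s, |s| ≤ |t| → ‖φ' s + s * φ s‖ ≤ K) :
    ‖φ t - Complex.exp (-t ^ 2 / 2)‖ ≤ K * |t| := by
  have hd : ∀ s : ℝ, HasDerivAt (fun s : ℝ => φ s * Complex.exp ((s : ℂ) ^ 2 / 2))
      ((φ' s + s * φ s) * Complex.exp ((s : ℂ) ^ 2 / 2)) s := by
    intro s
    have h1 : HasDerivAt (fun s : ℝ => Complex.exp ((s : ℂ) ^ 2 / 2))
        (Complex.exp ((s : ℂ) ^ 2 / 2) * s) s := by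
      have h2 : HasDerivAt (fun z : ℂ => Complex.exp (z ^ 2 / 2))
          (Complex.exp ((s : ℂ) ^ 2 / 2) * s) (s : ℂ) := by
        have h3 : HasDerivAt (fun z : ℂ => z ^ 2 / 2) (s : ℂ) (s : ℂ) := by
          have := (hasDerivAt_pow 2 (s : ℂ)).div_const 2
          simpa using this
        exact h3.cexp
      exact h2.comp_ofReal
    convert! (hφ s).mul h1 using 1
    ring
  have hn : ∀ s : ℝ, ‖Complex.exp ((s : ℂ) ^ 2 / 2)‖ = Real.exp (s ^ 2 / 2) := by
    intro s
    have : (s : ℂ) ^ 2 / 2 = ((s ^ 2 / 2 : ℝ) : ℂ) := by push_cast; rfl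
    rw [this, Complex.norm_exp, Complex.ofReal_re]
  have hm := (convex_Icc (-|t|) |t|).norm_image_sub_le_of_norm_hasDerivWithin_le
    (f := fun s : ℝ => φ s * Complex.exp ((s : ℂ) ^ 2 / 2)) (C := K * Real.exp (t ^ 2 / 2))
    (fun s _ => (hd s).hasDerivWithinAt) (fun s hs => ?_)
    (x := 0) (y := t) (by simp) ⟨neg_abs_le t, le_abs_self t⟩
  · simp only [Complex.ofReal_zero, h0] at hm
    have e : φ t - Complex.exp (-t ^ 2 / 2) =
        Complex.exp (-(t ^ 2 / 2)) *
          (φ t * Complex.exp ((t : ℂ) ^ 2 / 2) - 1 * Complex.exp (0 ^ 2 / 2)) := by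
      rw [mul_sub, mul_left_comm, ← Complex.exp_add]
      simp [neg_div]
    have hn' : ‖Complex.exp (-((t : ℂ) ^ 2 / 2))‖ = (Real.exp (t ^ 2 / 2))⁻¹ := by
      rw [Complex.exp_neg, norm_inv, hn]
    rw [e, norm_mul, hn']
    have hpos := Real.exp_pos (t ^ 2 / 2)
    rw [inv_mul_le_iff₀ hpos]
    refine hm.trans_eq ?_
    rw [sub_zero, Real.norm_eq_abs]
    ring
  · have hs' : |s| ≤ |t| := abs_le.mpr hs
    rw [norm_mul, hn]
    have hKs := hK s hs'
    exact mul_le_mul hKs (Real.exp_le_exp.mpr (by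
      have := sq_le_sq.mpr hs'; linarith)) (Real.exp_pos _).le ((norm_nonneg _).trans hKs)

section Stein

variable {E : Type*} {mE : MeasurableSpace E} {μ : Measure E}

lemma integrable_ofReal_mul_exp {f Q : E → ℝ} (hf : Integrable f μ) (hQ : Measurable Q) (t : ℝ) :
    Integrable (fun ω => (f ω : ℂ) * Complex.exp (↑(t * Q ω) * Complex.I)) μ := by
  refine hf.norm.mono' (hf.1.aemeasurable.complex_ofReal.aestronglyMeasurable.mul
    (by fun_prop : Measurable _).aestronglyMeasurable) (ae_of_all _ fun ω => ?_)
  rw [norm_mul, Complex.norm_exp_ofReal_mul_I, mul_one, Complex.norm_real]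

variable [IsProbabilityMeasure μ]

lemma hasDerivAt_integral_exp_mul_I {Q : E → ℝ} (hQm : Measurable Q) (hQ : Integrable Q μ)
    (t : ℝ) :
    HasDerivAt (fun t : ℝ => ∫ ω, Complex.exp (↑(t * Q ω) * Complex.I) ∂μ)
      (∫ ω, Q ω * Complex.I * Complex.exp (↑(t * Q ω) * Complex.I) ∂μ) t := by
  refine (hasDerivAt_integral_of_dominated_loc_of_deriv_le (s := Set.univ) (bound := fun ω => |Q ω|)
    (F := fun (t : ℝ) ω => Complex.exp (↑(t * Q ω) * Complex.I))
    (F' := fun (t : ℝ) ω => Q ω * Complex.I * Complex.exp (↑(t * Q ω) * Complex.I))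
    Filter.univ_mem (Eventually.of_forall fun s => ?_) ?_ ?_ ?_ hQ.abs ?_).2
  · exact (by fun_prop : Measurable _).aestronglyMeasurable
  · refine (integrable_const (1 : ℝ)).mono' (by fun_prop : Measurable _).aestronglyMeasurable
      (ae_of_all _ fun ω => ?_)
    rw [Complex.norm_exp_ofReal_mul_I]
  · exact (by fun_prop : Measurable _).aestronglyMeasurable
  · refine ae_of_all _ fun ω s _ => ?_
    rw [norm_mul, Complex.norm_exp_ofReal_mul_I]
    simp
  · refine ae_of_all _ fun ω s _ => ?_
    have h : HasDerivAt (fun z : ℂ => Complex.exp (z * Q ω * Complex.I))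
        (Complex.exp (s * Q ω * Complex.I) * (Q ω * Complex.I)) (s : ℂ) := by
      have : HasDerivAt (fun z : ℂ => z * Q ω * Complex.I) (Q ω * Complex.I) (s : ℂ) := by
        simpa using ((hasDerivAt_id (s : ℂ)).mul_const (Q ω : ℂ)).mul_const Complex.I
      exact this.cexp
    have h' := h.comp_ofReal
    simp only [Complex.ofReal_mul]
    convert! h' using 1
    ring

/-- Taylor expansion of `exp (i t (U + x W))` in the independent variable `x`, tested against
`x W`: integration by parts up to third-order terms. Absolute third moments are bounded by even
ones through `2 |y| ^ 3 ≤ c y ^ 2 + y ^ 4 / c`. -/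
lemma norm_integral_mul_exp_sub_le {x W U : E → ℝ} (h : IndepFun x (fun ω => (W ω, U ω)) μ)
    (hxm : Measurable x) (hWm : Measurable W) (hUm : Measurable U)
    (hx : MemLp x 4 μ) (hW : MemLp W 4 μ)
    (hx1 : ∫ ω, x ω ∂μ = 0) (hx2 : ∫ ω, x ω ^ 2 ∂μ = 1) {M : ℝ} (hM1 : 1 ≤ M)
    (hM : ∫ ω, x ω ^ 4 ∂μ ≤ M) {c : ℝ} (hc : 0 < c) (t : ℝ) :
    ‖∫ ω, (x ω * W ω * Complex.exp (↑(t * (U ω + x ω * W ω)) * Complex.I)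
        - t * Complex.I * (W ω ^ 2 * Complex.exp (↑(t * (U ω + x ω * W ω)) * Complex.I))) ∂μ‖ ≤
      t ^ 2 * (3 / 2 * (c * ∫ ω, W ω ^ 2 ∂μ + M * (∫ ω, W ω ^ 4 ∂μ) / c)) := by
  have hWU : Measurable (fun ω => (W ω, U ω)) := hWm.prodMk hUm
  have hx2' : MemLp x 2 μ := hx.mono_exponent (by norm_num)
  have hW2' : MemLp W 2 μ := hW.mono_exponent (by norm_num)
  have iW4 := hW.integrable_pow_four
  have iW2 := hW2'.integrable_sq
  have ix4 := hx.integrable_pow_four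
  have ix2 := hx2'.integrable_sq
  have hxW2 : IndepFun (fun ω => x ω ^ 2) (fun ω => W ω ^ 2) μ :=
    h.comp (φ := fun a => a ^ 2) (ψ := fun b : ℝ × ℝ => b.1 ^ 2) (by fun_prop) (by fun_prop)
  have hxW4 : IndepFun (fun ω => x ω ^ 4) (fun ω => W ω ^ 4) μ :=
    h.comp (φ := fun a => a ^ 4) (ψ := fun b : ℝ × ℝ => b.1 ^ 4) (by fun_prop) (by fun_prop)
  have i22 : Integrable (fun ω => x ω ^ 2 * W ω ^ 2) μ := hxW2.integrable_mul ix2 iW2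
  have i44 : Integrable (fun ω => x ω ^ 4 * W ω ^ 4) μ := hxW4.integrable_mul ix4 iW4
  have v22 : ∫ ω, x ω ^ 2 * W ω ^ 2 ∂μ = ∫ ω, W ω ^ 2 ∂μ := by
    rw [hxW2.integral_fun_mul_eq_mul_integral ix2.1 iW2.1, hx2, one_mul]
  have v44 : ∫ ω, x ω ^ 4 * W ω ^ 4 ∂μ ≤ M * ∫ ω, W ω ^ 4 ∂μ := by
    rw [hxW4.integral_fun_mul_eq_mul_integral ix4.1 iW4.1]
    exact mul_le_mul_of_nonneg_right hM (integral_nonneg fun ω => by positivity)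
  set e : E → ℂ := fun ω => Complex.exp (↑(t * U ω) * Complex.I) with he
  have hem : Measurable e := by fun_prop
  have hen : ∀ ω, ‖e ω‖ = 1 := fun ω => Complex.norm_exp_ofReal_mul_I _
  set z : E → ℂ := fun ω => Complex.exp (↑(t * (x ω * W ω)) * Complex.I) with hz
  have hzm : Measurable z := by fun_prop
  -- the two terms that vanish by independence
  have z1 : ∫ ω, (x ω : ℂ) * (W ω * e ω) ∂μ = 0 := by
    have := h.integral_fun_comp_mul_comp (f := fun a : ℝ => (a : ℂ))
      (g := fun b : ℝ × ℝ => (b.1 : ℂ) * Complex.exp (↑(t * b.2) * Complex.I))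
      hxm.aemeasurable hWU.aemeasurable (by fun_prop : Measurable _).aestronglyMeasurable
      (by fun_prop : Measurable _).aestronglyMeasurable
    rw [this, integral_complex_ofReal, hx1]
    simp
  have z2 : ∫ ω, ((x ω ^ 2 - 1 : ℝ) : ℂ) * (t * Complex.I * (W ω ^ 2 * e ω)) ∂μ = 0 := by
    have := h.integral_fun_comp_mul_comp (f := fun a : ℝ => ((a ^ 2 - 1 : ℝ) : ℂ))
      (g := fun b : ℝ × ℝ => t * Complex.I * (b.1 ^ 2 * Complex.exp (↑(t * b.2) * Complex.I)))
      hxm.aemeasurable hWU.aemeasurable (by fun_prop : Measurable _).aestronglyMeasurable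
      (by fun_prop : Measurable _).aestronglyMeasurable
    rw [this, integral_complex_ofReal, integral_sub ix2 (by fun_prop), hx2]
    simp
  set R : E → ℂ := fun ω => x ω * W ω * e ω * (z ω - 1 - ↑(t * (x ω * W ω)) * Complex.I)
    + t * Complex.I * (W ω ^ 2 * e ω * (1 - z ω)) with hR
  have hRm : Measurable R := by fun_prop
  -- the two vanishing terms plus a remainder of third order in `t x W`
  have hdec : ∀ ω, (x ω * W ω * Complex.exp (↑(t * (U ω + x ω * W ω)) * Complex.I)
        - t * Complex.I * (W ω ^ 2 * Complex.exp (↑(t * (U ω + x ω * W ω)) * Complex.I))) =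
      (x ω : ℂ) * (W ω * e ω) + ((x ω ^ 2 - 1 : ℝ) : ℂ) * (t * Complex.I * (W ω ^ 2 * e ω))
        + R ω := by
    intro ω
    have : Complex.exp (↑(t * (U ω + x ω * W ω)) * Complex.I) = e ω * z ω := by
      rw [he, hz, ← Complex.exp_add]
      congr 1
      push_cast
      ring
    rw [this, hR]
    push_cast
    ring
  set g : E → ℝ := fun ω => t ^ 2 * ((c * (x ω ^ 2 * W ω ^ 2) + (x ω ^ 4 * W ω ^ 4) / c)
    + 1 / 2 * (c * (x ω ^ 2 * W ω ^ 2) + W ω ^ 4 / c)) with hg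
  have hgi : Integrable g μ := by fun_prop
  -- `c` is a free parameter that stands for the size of the error
  have hamgm : ∀ a b : ℝ, |a| * |b| ≤ 1 / 2 * (c * a ^ 2 + b ^ 2 / c) := by
    intro a b
    have h1 : 0 ≤ (c * |a| - |b|) ^ 2 / c := by positivity
    have h2 : (c * |a| - |b|) ^ 2 / c = c * a ^ 2 - 2 * (|a| * |b|) + b ^ 2 / c := by
      rw [← sq_abs a, ← sq_abs b]; field_simp; ring
    linarith
  have hRg : ∀ ω, ‖R ω‖ ≤ g ω := by
    intro ω
    have h1 := norm_exp_ofReal_mul_I_sub_one_sub_le (t * (x ω * W ω))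
    have h2 := norm_exp_ofReal_mul_I_sub_one_le (t * (x ω * W ω))
    rw [norm_sub_rev] at h2
    have h3 := hamgm (x ω * W ω) ((x ω * W ω) ^ 2)
    have h4 := hamgm (x ω * W ω) (W ω ^ 2)
    have ha : 0 ≤ |x ω * W ω| := abs_nonneg _
    have e2 : |(x ω * W ω) ^ 2| = (x ω * W ω) ^ 2 := abs_of_nonneg (by positivity)
    have e3 : |W ω ^ 2| = W ω ^ 2 := abs_of_nonneg (by positivity)
    rw [e2] at h3
    rw [e3] at h4
    have n1 : ‖(x ω : ℂ) * W ω * e ω * (z ω - 1 - ↑(t * (x ω * W ω)) * Complex.I)‖ ≤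
        |x ω * W ω| * (2 * (t * (x ω * W ω)) ^ 2) := by
      rw [norm_mul, norm_mul, hen, mul_one, ← Complex.ofReal_mul, Complex.norm_real,
        Real.norm_eq_abs]
      gcongr
    have n2 : ‖(t : ℂ) * Complex.I * (W ω ^ 2 * e ω * (1 - z ω))‖ ≤
        |t| * (W ω ^ 2 * |t * (x ω * W ω)|) := by
      rw [norm_mul, norm_mul, norm_mul, norm_mul, hen, mul_one, ← Complex.ofReal_pow,
        Complex.norm_real, Complex.norm_real, Complex.norm_I, mul_one, Real.norm_eq_abs,
        Real.norm_eq_abs, e3]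
      gcongr
    refine (norm_add_le _ _).trans ((add_le_add n1 n2).trans ?_)
    have e4 : |x ω * W ω| * (2 * (t * (x ω * W ω)) ^ 2) + |t| * (W ω ^ 2 * |t * (x ω * W ω)|) =
        t ^ 2 * (2 * (|x ω * W ω| * (x ω * W ω) ^ 2) + |x ω * W ω| * W ω ^ 2) := by
      rw [abs_mul t, ← sq_abs t]; ring_nf; rw [sq_abs]
    rw [e4, hg]
    refine mul_le_mul_of_nonneg_left ?_ (sq_nonneg t)
    have e5 : ((x ω * W ω) ^ 2) ^ 2 = x ω ^ 4 * W ω ^ 4 := by ring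
    have e6 : (x ω * W ω) ^ 2 = x ω ^ 2 * W ω ^ 2 := by ring
    have e7 : (W ω ^ 2) ^ 2 = W ω ^ 4 := by ring
    rw [e5, e6] at h3
    rw [e6, e7] at h4
    rw [e6]
    linarith
  have hRi : Integrable R μ := hgi.mono' hRm.aestronglyMeasurable (ae_of_all _ hRg)
  have iz1 : Integrable (fun ω => (x ω : ℂ) * (W ω * e ω)) μ := by
    refine (hx2'.integrable_mul_two hW2').norm.mono'
      (by fun_prop : Measurable _).aestronglyMeasurable (ae_of_all _ fun ω => ?_)
    rw [norm_mul, norm_mul, hen, mul_one, norm_mul, Complex.norm_real, Complex.norm_real]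
  have iz2 : Integrable
      (fun ω => ((x ω ^ 2 - 1 : ℝ) : ℂ) * (t * Complex.I * (W ω ^ 2 * e ω))) μ := by
    have hi : Integrable (fun ω => |t| * (x ω ^ 2 * W ω ^ 2 + W ω ^ 2)) μ := by fun_prop
    refine hi.mono' (by fun_prop : Measurable _).aestronglyMeasurable (ae_of_all _ fun ω => ?_)
    rw [norm_mul, norm_mul, norm_mul, norm_mul, hen, mul_one, ← Complex.ofReal_pow,
      Complex.norm_real, Complex.norm_real, Complex.norm_real, Complex.norm_I, mul_one,
      Real.norm_eq_abs, Real.norm_eq_abs, Real.norm_eq_abs, abs_of_nonneg (sq_nonneg (W ω))]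
    have : |x ω ^ 2 - 1| ≤ x ω ^ 2 + 1 := by
      rw [abs_le]; constructor <;> nlinarith [sq_nonneg (x ω)]
    calc _ ≤ (x ω ^ 2 + 1) * (|t| * W ω ^ 2) := by gcongr
      _ = _ := by ring
  simp_rw [hdec]
  have iz12 : Integrable (fun ω => (x ω : ℂ) * (W ω * e ω) +
    ((x ω ^ 2 - 1 : ℝ) : ℂ) * (t * Complex.I * (W ω ^ 2 * e ω))) μ := iz1.add iz2
  rw [integral_add iz12 hRi, integral_add iz1 iz2, z1, z2, add_zero, zero_add]
  refine (norm_integral_le_of_norm_le hgi (ae_of_all _ hRg)).trans ?_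
  rw [hg, integral_const_mul]
  refine mul_le_mul_of_nonneg_left ?_ (sq_nonneg t)
  rw [integral_add (by fun_prop) (by fun_prop), integral_const_mul,
    integral_add (by fun_prop) (by fun_prop), integral_add (by fun_prop) (by fun_prop),
    integral_const_mul, integral_div, integral_div, v22]
  have hW0 : 0 ≤ ∫ ω, W ω ^ 4 ∂μ := integral_nonneg fun ω => by positivity
  have b1 : (∫ ω, x ω ^ 4 * W ω ^ 4 ∂μ) / c ≤ M * (∫ ω, W ω ^ 4 ∂μ) / c := by gcongr
  have b2 : (∫ ω, W ω ^ 4 ∂μ) / c ≤ M * (∫ ω, W ω ^ 4 ∂μ) / c := by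
    gcongr; nlinarith
  linarith

end Stein

/-- Half the sum of the squared partial derivatives of the quadratic form of `B` is the quadratic
form of `2 B²`. -/
lemma sum_sq_eq_quadratic {ι : Type*} [Fintype ι] {B : Matrix ι ι ℝ} (hB : B.IsSymm) (x : ι → ℝ) :
    1 / 2 * ∑ j, (∑ i, 2 * B i j * x i) ^ 2 =
      ∑ i, ∑ k, ((2 : ℝ) • (B * B)) i k * (x i * x k) := by
  have e : ∀ j, (∑ i, 2 * B i j * x i) ^ 2 =
      ∑ i, ∑ k, 4 * (B i j * B j k) * (x i * x k) := by
    intro j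
    rw [sq, Finset.sum_mul_sum]
    refine Finset.sum_congr rfl fun i _ => Finset.sum_congr rfl fun k _ => ?_
    rw [hB.apply k j]
    ring
  simp_rw [e]
  rw [Finset.sum_comm, Finset.mul_sum]
  refine Finset.sum_congr rfl fun i _ => ?_
  rw [Finset.sum_comm, Finset.mul_sum]
  refine Finset.sum_congr rfl fun k _ => ?_
  rw [Matrix.smul_apply, Matrix.mul_apply, ← Finset.sum_mul, ← Finset.mul_sum, smul_eq_mul]
  ring

namespace IsStandardIndep

variable {E ι : Type*} {mE : MeasurableSpace E} {μ : Measure E} [IsProbabilityMeasure μ]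
  [Fintype ι] [DecidableEq ι] {X : ι → E → ℝ}

/-- One variable's contribution to the differential equation for the characteristic function of an
off-diagonal quadratic form. -/
lemma norm_integral_coord_le (hX : IsStandardIndep X μ) {B : Matrix ι ι ℝ} (hB : B.IsSymm)
    (hB0 : ∀ i, B i i = 0) {M : ℝ} (hM1 : 1 ≤ M) (hM : ∀ i, ∫ ω, X i ω ^ 4 ∂μ ≤ M)
    {c : ℝ} (hc : 0 < c) (j : ι) (h2 : M ^ 2 * ∑ i, B i j ^ 2 ≤ c ^ 2) (t : ℝ) :
    ‖∫ ω, (X j ω * (∑ i, 2 * B i j * X i ω : ℝ) *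
          Complex.exp (↑(t * ∑ i, ∑ k, B i k * (X i ω * X k ω)) * Complex.I)
        - t * Complex.I * ((∑ i, 2 * B i j * X i ω : ℝ) ^ 2 *
          Complex.exp (↑(t * ∑ i, ∑ k, B i k * (X i ω * X k ω)) * Complex.I))) ∂μ‖ ≤
      102 * t ^ 2 * c * ∑ i, B i j ^ 2 := by
  set s := Finset.univ.erase j with hs
  have hj : j ∉ s := by simp [hs]
  have huniv : insert j s = Finset.univ := Finset.insert_erase (Finset.mem_univ j)
  have eW : ∀ ω, ∑ i, 2 * B i j * X i ω = ∑ i ∈ s, 2 * B i j * X i ω := by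
    intro ω
    rw [← huniv, Finset.sum_insert hj, hB0]
    ring
  -- the part of the form without `X j`, plus `X j` times the partial derivative
  have eQ : ∀ ω, ∑ i, ∑ k, B i k * (X i ω * X k ω) =
      ∑ i ∈ s, ∑ k ∈ s, B i k * (X i ω * X k ω) + X j ω * ∑ i ∈ s, 2 * B i j * X i ω := by
    intro ω
    simp_rw [← huniv, Finset.sum_insert hj, Finset.sum_add_distrib, Finset.mul_sum]
    have h1 : ∀ k, B j k * (X j ω * X k ω) = X j ω * (B k j * X k ω) := by
      intro k; rw [hB.apply k j]; ring
    have h2 : ∀ k, B k j * (X k ω * X j ω) = X j ω * (B k j * X k ω) := by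
      intro k; ring
    have h3 : ∀ k, X j ω * (2 * B k j * X k ω) =
        X j ω * (B k j * X k ω) + X j ω * (B k j * X k ω) := by
      intro k; ring
    simp_rw [h1, h2, h3, Finset.sum_add_distrib, hB0]
    ring
  have er : ∑ i, B i j ^ 2 = ∑ i ∈ s, B i j ^ 2 := by
    rw [← huniv, Finset.sum_insert hj, hB0]
    ring
  simp_rw [eW, eQ]
  rw [er] at h2 ⊢
  have hind : IndepFun (X j) (fun ω => (∑ i ∈ s, 2 * B i j * X i ω,
      ∑ i ∈ s, ∑ k ∈ s, B i k * (X i ω * X k ω))) μ := by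
    have h := (hX.indepFun_restrict hj).comp (φ := id)
      (ψ := fun y => (∑ i ∈ s, 2 * B i j * y i, ∑ i ∈ s, ∑ k ∈ s, B i k * (y i * y k)))
      measurable_id (by fun_prop)
    convert! h using 1
    funext ω
    refine Prod.ext ?_ ?_
    · exact Finset.sum_congr rfl fun i hi => by simp [hi]
    · exact Finset.sum_congr rfl fun i hi => Finset.sum_congr rfl fun j hj => by simp [hi, hj]
  refine (norm_integral_mul_exp_sub_le hind (hX.measurable j) (hX.measurable_linear s _)
    (hX.measurable_quadratic s B) (hX.memLp j) (hX.memLp_linear s _) (hX.integral_eq_zero j)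
    (hX.integral_sq j) hM1 (hM j) hc t).trans ?_
  have h4 := hX.integral_linear_pow_four_le hM s (fun i => 2 * B i j)
  rw [hX.integral_linear_sq]
  have e4 : ∑ i ∈ s, (2 * B i j) ^ 2 = 4 * ∑ i ∈ s, B i j ^ 2 := by
    rw [Finset.mul_sum]; exact Finset.sum_congr rfl fun i _ => by ring
  rw [e4] at h4 ⊢
  set r := ∑ i ∈ s, B i j ^ 2 with hr
  have hr0 : 0 ≤ r := Finset.sum_nonneg fun i _ => sq_nonneg _
  have h5 : M * (∫ ω, (∑ i ∈ s, 2 * B i j * X i ω) ^ 4 ∂μ) / c ≤ 64 * c * r := by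
    rw [div_le_iff₀ hc]
    calc M * (∫ ω, (∑ i ∈ s, 2 * B i j * X i ω) ^ 4 ∂μ)
        ≤ M * ((4 * M) * (4 * r) ^ 2) := by
          refine mul_le_mul_of_nonneg_left (h4.trans ?_) (by linarith)
          gcongr
          linarith
      _ = 64 * r * (M ^ 2 * r) := by ring
      _ ≤ 64 * r * c ^ 2 := by gcongr
      _ = 64 * c * r * c := by ring
  calc t ^ 2 * (3 / 2 * (c * (4 * r) + M * (∫ ω, (∑ i ∈ s, 2 * B i j * X i ω) ^ 4 ∂μ) / c))
      ≤ t ^ 2 * (3 / 2 * (c * (4 * r) + 64 * c * r)) := by gcongr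
    _ = 102 * t ^ 2 * c * r := by ring

/-- The sum of the squared partial derivatives concentrates: its mean is close to `1` and its
variance is controlled by `‖B²‖_F` and the row sums of squares. -/
lemma integral_abs_sum_sq_sub_one_le (hX : IsStandardIndep X μ) {B : Matrix ι ι ℝ}
    (hB : B.IsSymm) {M : ℝ} (hM1 : 1 ≤ M) (hM : ∀ i, ∫ ω, X i ω ^ 4 ∂μ ≤ M)
    {c : ℝ} (hc0 : 0 < c) (hc1 : c ≤ 1)
    (h1 : 2 * ∑ j, ∑ i, B i j ^ 2 ≤ 1) (h1' : 1 - c ^ 2 ≤ 2 * ∑ j, ∑ i, B i j ^ 2)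
    (h2 : ∀ j, M ^ 2 * ∑ i, B i j ^ 2 ≤ c ^ 2)
    (h3 : ∑ i, ∑ j, (B * B) i j ^ 2 ≤ c ^ 2) :
    Integrable (fun ω => 1 / 2 * ∑ j, (∑ i, 2 * B i j * X i ω) ^ 2) μ ∧
    ∫ ω, |1 / 2 * ∑ j, (∑ i, 2 * B i j * X i ω) ^ 2 - 1| ∂μ ≤ 7 * c := by
  simp_rw [sum_sq_eq_quadratic hB]
  set C : Matrix ι ι ℝ := (2 : ℝ) • (B * B) with hC
  have hCs : C.IsSymm := by
    rw [hC, Matrix.IsSymm, Matrix.transpose_smul, Matrix.transpose_mul, hB.eq]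
  have hCd : ∀ j, C j j = 2 * ∑ i, B i j ^ 2 := by
    intro j
    rw [hC, Matrix.smul_apply, Matrix.mul_apply, smul_eq_mul]
    congr 1
    exact Finset.sum_congr rfl fun i _ => by rw [hB.apply i j]; ring
  have hV := hX.integral_quadratic_sub_trace_sq Finset.univ hCs
  have hVm := hX.memLp_quadratic Finset.univ C
  set V : E → ℝ := fun ω => ∑ i, ∑ k, C i k * (X i ω * X k ω) with hVdef
  set v : ℝ := ∑ i, C i i with hv
  have hvB : v = 2 * ∑ j, ∑ i, B i j ^ 2 := by
    rw [hv, Finset.mul_sum]; exact Finset.sum_congr rfl fun j _ => hCd j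
  have hVi : Integrable V μ := hVm.integrable (by norm_num)
  refine ⟨hVi, ?_⟩
  have hVs : Integrable (fun ω => (V ω - v) ^ 2) μ := (hVm.sub (memLp_const v)).integrable_sq
  have hvar : ∫ ω, (V ω - v) ^ 2 ∂μ ≤ 10 * c ^ 2 := by
    rw [hV]
    have a1 : ∑ i, ∑ j, C i j ^ 2 ≤ 4 * c ^ 2 := by
      refine le_trans (le_of_eq ?_) (mul_le_mul_of_nonneg_left h3 (by norm_num : (0 : ℝ) ≤ 4))
      simp_rw [Finset.mul_sum]
      refine Finset.sum_congr rfl fun i _ => Finset.sum_congr rfl fun k _ => ?_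
      rw [hC, Matrix.smul_apply, smul_eq_mul]
      ring
    have a2 : ∑ i, C i i ^ 2 * (∫ ω, X i ω ^ 4 ∂μ - 3) ≤ 2 * c ^ 2 := by
      have : ∀ i, C i i ^ 2 * (∫ ω, X i ω ^ 4 ∂μ - 3) ≤ 4 * c ^ 2 * ∑ k, B k i ^ 2 := by
        intro i
        have hr0 : 0 ≤ ∑ k, B k i ^ 2 := Finset.sum_nonneg fun k _ => sq_nonneg _
        rw [hCd]
        calc (2 * ∑ k, B k i ^ 2) ^ 2 * (∫ ω, X i ω ^ 4 ∂μ - 3)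
            ≤ (2 * ∑ k, B k i ^ 2) ^ 2 * M ^ 2 := by
              gcongr
              nlinarith [hM i]
          _ = 4 * (M ^ 2 * ∑ k, B k i ^ 2) * ∑ k, B k i ^ 2 := by ring
          _ ≤ 4 * c ^ 2 * ∑ k, B k i ^ 2 := by gcongr; exact h2 i
      refine (Finset.sum_le_sum fun i _ => this i).trans ?_
      rw [← Finset.mul_sum]
      nlinarith [sq_nonneg c]
    linarith
  have hpt : ∀ ω, |V ω - 1| ≤ (c / 2 + (V ω - v) ^ 2 / (2 * c)) + c ^ 2 := by
    intro ω
    have b1 : |V ω - v| ≤ c / 2 + (V ω - v) ^ 2 / (2 * c) := by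
      have : 0 ≤ (c - |V ω - v|) ^ 2 / (2 * c) := by positivity
      have e : (c - |V ω - v|) ^ 2 / (2 * c) = c / 2 - |V ω - v| + (V ω - v) ^ 2 / (2 * c) := by
        rw [← sq_abs (V ω - v)]; field_simp; ring
      linarith
    have b2 : |v - 1| ≤ c ^ 2 := by
      rw [abs_le]; constructor <;> nlinarith [sq_nonneg c]
    calc |V ω - 1| = |(V ω - v) + (v - 1)| := by congr 1; ring
      _ ≤ |V ω - v| + |v - 1| := abs_add_le _ _
      _ ≤ _ := add_le_add b1 b2
  refine (integral_mono (hVi.sub (integrable_const 1)).abs (by fun_prop) hpt).trans ?_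
  rw [integral_add (by fun_prop) (by fun_prop), integral_add (by fun_prop) (by fun_prop)]
  simp only [integral_const, probReal_univ, smul_eq_mul, one_mul]
  rw [integral_div]
  have : (∫ ω, (V ω - v) ^ 2 ∂μ) / (2 * c) ≤ 5 * c := by
    rw [div_le_iff₀ (by positivity)]; nlinarith
  have hcc : c ^ 2 ≤ c := by nlinarith
  linarith

/-- Quantitative normal approximation for an off-diagonal quadratic form of variance about `1`. -/
theorem norm_integral_exp_quadratic_sub_le (hX : IsStandardIndep X μ) {B : Matrix ι ι ℝ}
    (hB : B.IsSymm) (hB0 : ∀ i, B i i = 0) {M : ℝ} (hM1 : 1 ≤ M)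
    (hM : ∀ i, ∫ ω, X i ω ^ 4 ∂μ ≤ M) {c : ℝ} (hc0 : 0 < c) (hc1 : c ≤ 1)
    (h1 : 2 * ∑ j, ∑ i, B i j ^ 2 ≤ 1) (h1' : 1 - c ^ 2 ≤ 2 * ∑ j, ∑ i, B i j ^ 2)
    (h2 : ∀ j, M ^ 2 * ∑ i, B i j ^ 2 ≤ c ^ 2)
    (h3 : ∑ i, ∑ j, (B * B) i j ^ 2 ≤ c ^ 2) (t : ℝ) :
    ‖∫ ω, Complex.exp (↑(t * ∑ i, ∑ k, B i k * (X i ω * X k ω)) * Complex.I) ∂μ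
        - Complex.exp (-t ^ 2 / 2)‖ ≤ (26 * t ^ 2 + 7 * |t|) * c * |t| := by
  obtain ⟨hVi, hV⟩ := hX.integral_abs_sum_sq_sub_one_le hB hM1 hM hc0 hc1 h1 h1' h2 h3
  have hcoord := fun j => hX.norm_integral_coord_le hB hB0 hM1 hM hc0 j (h2 j)
  have hQm := hX.measurable_quadratic Finset.univ B
  have hQi : Integrable (fun ω => ∑ i, ∑ k, B i k * (X i ω * X k ω)) μ :=
    (hX.memLp_quadratic Finset.univ B).integrable (by norm_num)
  have hQS : ∀ ω, ∑ i, ∑ k, B i k * (X i ω * X k ω) =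
      1 / 2 * ∑ j, X j ω * ∑ i, 2 * B i j * X i ω := by
    intro ω
    rw [Finset.sum_comm, Finset.mul_sum]
    refine Finset.sum_congr rfl fun j _ => ?_
    rw [Finset.mul_sum, Finset.mul_sum]
    exact Finset.sum_congr rfl fun i _ => by ring
  have hSm := fun j => hX.memLp_linear Finset.univ (fun i => 2 * B i j)
  set Q : E → ℝ := fun ω => ∑ i, ∑ k, B i k * (X i ω * X k ω) with hQ
  set S : ι → E → ℝ := fun j ω => ∑ i, 2 * B i j * X i ω with hS
  have hXS : ∀ j, Integrable (fun ω => X j ω * S j ω) μ := fun j =>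
    ((hX.memLp j).mul_four (hSm j)).integrable (by norm_num)
  have hSS : ∀ j, Integrable (fun ω => S j ω ^ 2) μ := fun j =>
    ((hSm j).mono_exponent (by norm_num : (2 : ℝ≥0∞) ≤ 4)).integrable_sq
  refine norm_sub_exp_neg_sq_div_two_le (fun s => hasDerivAt_integral_exp_mul_I hQm hQi s)
    (by simp) t fun s hs => ?_
  set V : E → ℝ := fun ω => 1 / 2 * ∑ j, S j ω ^ 2 with hVdef
  set e : E → ℂ := fun ω => Complex.exp (↑(s * Q ω) * Complex.I) with he
  have hen : ∀ ω, ‖e ω‖ = 1 := fun ω => Complex.norm_exp_ofReal_mul_I _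
  have iT : ∀ j, Integrable (fun ω => (X j ω * S j ω * e ω -
      s * Complex.I * ((S j ω : ℂ) ^ 2 * e ω))) μ := by
    intro j
    have i1 := integrable_ofReal_mul_exp (hXS j) hQm s
    have i2 := integrable_ofReal_mul_exp (hSS j) hQm s
    refine (i1.sub (i2.const_mul (s * Complex.I))).congr (ae_of_all _ fun ω => ?_)
    simp [he]
  have iV : Integrable (fun ω => ((V ω - 1 : ℝ) : ℂ) * e ω) μ :=
    integrable_ofReal_mul_exp (hVi.sub (integrable_const 1)) hQm s
  have ie : Integrable e μ := by
    simpa [he] using integrable_ofReal_mul_exp (μ := μ) (integrable_const (1 : ℝ)) hQm s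
  have iQ : Integrable (fun ω => (Q ω : ℂ) * Complex.I * e ω) μ := by
    refine ((integrable_ofReal_mul_exp hQi hQm s).const_mul Complex.I).congr
      (ae_of_all _ fun ω => ?_)
    simp only [he]; ring
  -- the summands on the right are those of `norm_integral_coord_le`
  have hdec : ∀ ω, (Q ω : ℂ) * Complex.I * e ω + s * e ω =
      Complex.I * (1 / 2) * (∑ j, (X j ω * S j ω * e ω - s * Complex.I * ((S j ω : ℂ) ^ 2 * e ω)))
        - s * (((V ω - 1 : ℝ) : ℂ) * e ω) := by
    intro ω
    have hQ' : (Q ω : ℂ) = 1 / 2 * ∑ j, (X j ω : ℂ) * S j ω := by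
      rw [show Q ω = 1 / 2 * ∑ j, X j ω * S j ω from hQS ω]; push_cast; rfl
    have hV' : (V ω : ℂ) = 1 / 2 * ∑ j, (S j ω : ℂ) ^ 2 := by
      rw [hVdef]; push_cast; rfl
    rw [Finset.sum_sub_distrib, ← Finset.sum_mul, ← Finset.mul_sum, ← Finset.sum_mul, hQ']
    push_cast
    rw [hV']
    linear_combination (1 / 2 * s * (∑ j, (S j ω : ℂ) ^ 2) * e ω) * Complex.I_sq
  have hsum : (∫ ω, (Q ω : ℂ) * Complex.I * e ω ∂μ) + s * ∫ ω, e ω ∂μ =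
      Complex.I * (1 / 2) * (∑ j, ∫ ω, (X j ω * S j ω * e ω -
        s * Complex.I * ((S j ω : ℂ) ^ 2 * e ω)) ∂μ)
        - s * ∫ ω, ((V ω - 1 : ℝ) : ℂ) * e ω ∂μ := by
    rw [← integral_const_mul, ← integral_add iQ (ie.const_mul _)]
    simp_rw [hdec]
    rw [integral_sub ((integrable_finsetSum _ fun j _ => iT j).const_mul _) (iV.const_mul _),
      integral_const_mul, integral_const_mul, integral_finsetSum _ fun j _ => iT j]
  rw [hsum]
  have n1 : ‖∑ j, ∫ ω, (X j ω * S j ω * e ω - s * Complex.I * ((S j ω : ℂ) ^ 2 * e ω)) ∂μ‖ ≤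
      51 * s ^ 2 * c := by
    refine (norm_sum_le_of_le _ fun j _ => hcoord j s).trans ?_
    rw [← Finset.mul_sum]
    nlinarith [mul_nonneg (sq_nonneg s) hc0.le]
  have n2 : ‖∫ ω, ((V ω - 1 : ℝ) : ℂ) * e ω ∂μ‖ ≤ 7 * c := by
    refine (norm_integral_le_integral_norm _).trans (le_trans (le_of_eq ?_) hV)
    refine integral_congr_ae (ae_of_all _ fun ω => ?_)
    simp only [norm_mul, hen, mul_one, Complex.norm_real, Real.norm_eq_abs]
    rfl
  have hst : s ^ 2 ≤ t ^ 2 := sq_le_sq.mpr hs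
  calc _ ≤ 1 / 2 * (51 * s ^ 2 * c) + |s| * (7 * c) := by
        refine (norm_sub_le _ _).trans (add_le_add ?_ ?_)
        · rw [norm_mul]
          exact mul_le_mul (by rw [norm_mul, Complex.norm_I]; norm_num) n1 (norm_nonneg _)
            (by norm_num)
        · rw [norm_mul, Complex.norm_real, Real.norm_eq_abs]
          gcongr
    _ ≤ 1 / 2 * (51 * t ^ 2 * c) + |t| * (7 * c) := by gcongr
    _ ≤ (26 * t ^ 2 + 7 * |t|) * c := by nlinarith [mul_nonneg (sq_nonneg t) hc0.le]

end IsStandardIndep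

/-! ### Matrix norms -/

section Matrix

variable {n : ℕ}

lemma frobeniusNormMat_sq (A : Matrix (Fin n) (Fin n) ℝ) :
    frobeniusNormMat A ^ 2 = ∑ j, ∑ i, A i j ^ 2 := by
  have e : (Aᵀ * A).trace = ∑ j, ∑ i, A i j ^ 2 := by
    simp [Matrix.trace, Matrix.mul_apply, sq]
  rw [frobeniusNormMat, e, Real.sq_sqrt]
  exact Finset.sum_nonneg fun j _ => Finset.sum_nonneg fun i _ => sq_nonneg _

lemma frobeniusNormMat_pos {A : Matrix (Fin n) (Fin n) ℝ} (hA : A ≠ 0) :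
    0 < frobeniusNormMat A := by
  refine lt_of_le_of_ne (Real.sqrt_nonneg _) fun h => hA ?_
  have h2 := frobeniusNormMat_sq A
  rw [← h, zero_pow (by norm_num)] at h2
  have h3 := (Finset.sum_eq_zero_iff_of_nonneg fun j _ =>
    Finset.sum_nonneg fun i _ => sq_nonneg (A i j)).mp h2.symm
  ext i j
  have h4 := (Finset.sum_eq_zero_iff_of_nonneg fun i _ => sq_nonneg (A i j)).mp
    (h3 j (Finset.mem_univ j)) i (Finset.mem_univ i)
  simpa using h4

lemma sum_mulVec_sq_le (A : Matrix (Fin n) (Fin n) ℝ) (x : Fin n → ℝ) :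
    ∑ i, (A *ᵥ x) i ^ 2 ≤ spectralNormMat A ^ 2 * ∑ i, x i ^ 2 := by
  have h := (Matrix.toEuclideanCLM (n := Fin n) (𝕜 := ℝ) A).le_opNorm (WithLp.toLp 2 x)
  have h2 := pow_le_pow_left₀ (norm_nonneg _) h 2
  rw [mul_pow, EuclideanSpace.norm_sq_eq, EuclideanSpace.norm_sq_eq] at h2
  simpa [spectralNormMat, Matrix.toEuclideanCLM_toLp] using h2

lemma diag_sq_le_spectralNormMat_sq (A : Matrix (Fin n) (Fin n) ℝ) (i : Fin n) :
    A i i ^ 2 ≤ spectralNormMat A ^ 2 := by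
  have h := sum_mulVec_sq_le A (Pi.single i 1)
  have e : ∑ k, (Pi.single i 1 : Fin n → ℝ) k ^ 2 = 1 := by
    rw [Finset.sum_eq_single i] <;> simp +contextual
  rw [e, mul_one] at h
  refine le_trans ?_ h
  have := Finset.single_le_sum (f := fun k => (A *ᵥ Pi.single i 1) k ^ 2)
    (fun k _ => sq_nonneg _) (Finset.mem_univ i)
  simpa using this

/-- The off-diagonal part of `A`, scaled by `a`. -/
def offDiagScaled (a : ℝ) (A : Matrix (Fin n) (Fin n) ℝ) : Matrix (Fin n) (Fin n) ℝ :=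
  fun i j => if i = j then 0 else a * A i j

lemma offDiagScaled_isSymm (a : ℝ) {A : Matrix (Fin n) (Fin n) ℝ} (hA : A.IsSymm) :
    (offDiagScaled a A).IsSymm := by
  ext i j
  simp only [Matrix.transpose_apply, offDiagScaled, eq_comm, hA.apply i j]

lemma sum_offDiagScaled_sq (a : ℝ) (A : Matrix (Fin n) (Fin n) ℝ) (j : Fin n) :
    ∑ i, offDiagScaled a A i j ^ 2 = a ^ 2 * (∑ i, A i j ^ 2 - A j j ^ 2) := by
  have e : ∀ i, offDiagScaled a A i j ^ 2 =
      a ^ 2 * A i j ^ 2 - if i = j then a ^ 2 * A i j ^ 2 else 0 := by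
    intro i
    by_cases h : i = j <;> simp [offDiagScaled, h, mul_pow]
  simp_rw [e, Finset.sum_sub_distrib]
  rw [Finset.sum_ite_eq' Finset.univ j, ← Finset.mul_sum]
  simp
  ring

/-- For the scaled off-diagonal part `B` of `A`: `‖B²‖_F² ≤ (2 a ‖A‖_S)² ‖B‖_F²`, because removing
the diagonal at most doubles the spectral norm. -/
lemma sum_offDiagScaled_mul_self_sq_le (a : ℝ) (A : Matrix (Fin n) (Fin n) ℝ) :
    ∑ i, ∑ j, (offDiagScaled a A * offDiagScaled a A) i j ^ 2 ≤
      4 * a ^ 2 * spectralNormMat A ^ 2 * ∑ j, ∑ i, offDiagScaled a A i j ^ 2 := by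
  rw [Finset.sum_comm, Finset.mul_sum]
  refine Finset.sum_le_sum fun j _ => ?_
  set b : Fin n → ℝ := fun i => offDiagScaled a A i j with hb
  have e : ∀ i, (offDiagScaled a A * offDiagScaled a A) i j = a * ((A *ᵥ b) i - A i i * b i) := by
    intro i
    have h1 : ∀ k, offDiagScaled a A i k * offDiagScaled a A k j =
        a * (A i k * b k) - if i = k then a * (A i k * b k) else 0 := by
      intro k
      by_cases h : i = k
      · simp [offDiagScaled, h]
      · rw [if_neg h, sub_zero, hb]
        conv_lhs => rw [offDiagScaled]
        rw [if_neg h]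
        ring
    rw [Matrix.mul_apply]
    simp_rw [h1, Finset.sum_sub_distrib]
    rw [Finset.sum_ite_eq Finset.univ i, ← Finset.mul_sum]
    simp [Matrix.mulVec, dotProduct]
    ring
  have h2 : ∀ i, (offDiagScaled a A * offDiagScaled a A) i j ^ 2 ≤
      2 * a ^ 2 * ((A *ᵥ b) i ^ 2 + spectralNormMat A ^ 2 * b i ^ 2) := by
    intro i
    rw [e]
    have h3 : A i i ^ 2 * b i ^ 2 ≤ spectralNormMat A ^ 2 * b i ^ 2 :=
      mul_le_mul_of_nonneg_right (diag_sq_le_spectralNormMat_sq A i) (sq_nonneg _)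
    have h4 : ((A *ᵥ b) i - A i i * b i) ^ 2 ≤
        2 * ((A *ᵥ b) i ^ 2 + spectralNormMat A ^ 2 * b i ^ 2) := by
      nlinarith [sq_nonneg ((A *ᵥ b) i + A i i * b i)]
    rw [mul_pow]
    nlinarith [mul_le_mul_of_nonneg_left h4 (sq_nonneg a)]
  refine (Finset.sum_le_sum fun i _ => h2 i).trans ?_
  rw [← Finset.mul_sum, Finset.sum_add_distrib, ← Finset.mul_sum]
  nlinarith [mul_le_mul_of_nonneg_left (sum_mulVec_sq_le A b) (sq_nonneg a)]

lemma sq_apply_diag_eq_sum {A : Matrix (Fin n) (Fin n) ℝ} (hA : A.IsSymm) (j : Fin n) :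
    (A ^ 2) j j = ∑ i, A i j ^ 2 := by
  rw [sq, Matrix.mul_apply]
  exact Finset.sum_congr rfl fun i _ => by rw [hA.apply i j, sq]

lemma quadForm_eq_sum (A : Matrix (Fin n) (Fin n) ℝ) (z : Fin n → ℝ) :
    quadForm A z = ∑ i, ∑ j, A i j * (z i * z j) := by
  simp only [quadForm, dotProduct, Matrix.mulVec, Finset.mul_sum]
  exact Finset.sum_congr rfl fun i _ => Finset.sum_congr rfl fun j _ => by ring

end Matrix

/-! ### Normal approximation for quadratic forms with deterministic coefficients -/

namespace IsStandardIndep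

variable {E : Type*} {mE : MeasurableSpace E} {μ : Measure E} [IsProbabilityMeasure μ]
  {n : ℕ} {X : Fin n → E → ℝ}

/-- Quantitative normal approximation for the normalized quadratic form of a symmetric matrix: the
off-diagonal part is treated by `norm_integral_exp_quadratic_sub_le`, the diagonal part is
negligible in `L²`. -/
theorem norm_integral_exp_quadForm_sub_le (hX : IsStandardIndep X μ)
    {A : Matrix (Fin n) (Fin n) ℝ} (hA : A.IsSymm) (hA0 : A ≠ 0) {c : ℝ} (hc0 : 0 < c)
    (hc1 : c ≤ 1)
    (h1 : spectralNormMat A ^ 2 / frobeniusNormMat A ^ 2 * (⨆ j, ∫ ω, X j ω ^ 4 ∂μ) ≤ c ^ 2)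
    (h2 : (⨆ j, (A ^ 2) j j) / frobeniusNormMat A ^ 2 * (⨆ j, ∫ ω, X j ω ^ 4 ∂μ) ^ 2 ≤ c ^ 2)
    (h3 : ∑ j, A j j ^ 2 * (∫ ω, X j ω ^ 4 ∂μ) / frobeniusNormMat A ^ 2 ≤ c ^ 2) (t : ℝ) :
    ‖∫ ω, Complex.exp (↑(t * ((quadForm A (fun i => X i ω) - A.trace) /
          (√2 * frobeniusNormMat A))) * Complex.I) ∂μ - Complex.exp (-t ^ 2 / 2)‖ ≤
      ((26 * t ^ 2 + 7 * |t|) * |t| + |t|) * c := by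
  set F := frobeniusNormMat A with hF
  have hF0 : 0 < F := frobeniusNormMat_pos hA0
  have hF2 : F ^ 2 = ∑ j, ∑ i, A i j ^ 2 := frobeniusNormMat_sq A
  set M := ⨆ j, ∫ ω, X j ω ^ 4 ∂μ with hMdef
  have hM : ∀ i, ∫ ω, X i ω ^ 4 ∂μ ≤ M := fun i =>
    le_ciSup (f := fun j => ∫ ω, X j ω ^ 4 ∂μ) (Set.finite_range _).bddAbove i
  have hn : Nonempty (Fin n) := by
    by_contra h
    rw [not_nonempty_iff] at h
    exact hA0 (Subsingleton.elim _ _)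
  have hM1 : 1 ≤ M := (hX.one_le_integral_pow_four hn.some).trans (hM _)
  set a : ℝ := (√2 * F)⁻¹ with ha
  have ha2 : a ^ 2 = 1 / (2 * F ^ 2) := by
    rw [ha, inv_pow, mul_pow, Real.sq_sqrt (by norm_num), one_div]
  have haF : a ^ 2 * F ^ 2 = 1 / 2 := by rw [ha2]; field_simp
  set B := offDiagScaled a A with hB
  set d := ∑ j, A j j ^ 2 with hd
  have hd0 : 0 ≤ d := Finset.sum_nonneg fun j _ => sq_nonneg _
  have hsumB : ∑ j, ∑ i, B i j ^ 2 = a ^ 2 * (F ^ 2 - d) := by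
    simp_rw [hB, sum_offDiagScaled_sq]
    rw [← Finset.mul_sum, Finset.sum_sub_distrib, ← hF2]
  have hm4 : ∑ j, A j j ^ 2 * (∫ ω, X j ω ^ 4 ∂μ) ≤ c ^ 2 * F ^ 2 := by
    rwa [← Finset.sum_div, div_le_iff₀ (by positivity)] at h3
  have hdc : d ≤ c ^ 2 * F ^ 2 := by
    refine le_trans (Finset.sum_le_sum fun j _ => ?_) hm4
    exact le_mul_of_one_le_right (sq_nonneg _) (hX.one_le_integral_pow_four j)
  have hS : spectralNormMat A ^ 2 ≤ c ^ 2 * F ^ 2 := by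
    rw [← div_le_iff₀ (by positivity)]
    refine le_trans ?_ h1
    exact le_mul_of_one_le_right (by positivity) hM1
  have ha2' : 0 ≤ a ^ 2 := sq_nonneg a
  have had : a ^ 2 * d ≤ c ^ 2 / 2 := by
    calc a ^ 2 * d ≤ a ^ 2 * (c ^ 2 * F ^ 2) := by gcongr
      _ = c ^ 2 * (a ^ 2 * F ^ 2) := by ring
      _ = c ^ 2 / 2 := by rw [haF]; ring
  have had0 : 0 ≤ a ^ 2 * d := mul_nonneg ha2' hd0
  -- the off-diagonal part
  have hoff := hX.norm_integral_exp_quadratic_sub_le (offDiagScaled_isSymm a hA)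
    (fun i => by simp [offDiagScaled]) hM1 hM hc0 hc1
    (by rw [← hB, hsumB, mul_sub, haF]; linarith)
    (by rw [← hB, hsumB, mul_sub, haF]; linarith)
    (fun j => by
      rw [sum_offDiagScaled_sq]
      have hj : (A ^ 2) j j ≤ ⨆ j, (A ^ 2) j j :=
        le_ciSup (f := fun j => (A ^ 2) j j) (Set.finite_range _).bddAbove j
      rw [sq_apply_diag_eq_sum hA] at hj
      have h2' : (⨆ j, (A ^ 2) j j) * M ^ 2 ≤ c ^ 2 * F ^ 2 := by
        rwa [div_mul_eq_mul_div, div_le_iff₀ (by positivity)] at h2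
      have hMj : (∑ i, A i j ^ 2) * M ^ 2 ≤ c ^ 2 * F ^ 2 :=
        (mul_le_mul_of_nonneg_right hj (sq_nonneg M)).trans h2'
      calc M ^ 2 * (a ^ 2 * (∑ i, A i j ^ 2 - A j j ^ 2))
          ≤ M ^ 2 * (a ^ 2 * ∑ i, A i j ^ 2) := by
            gcongr
            linarith [sq_nonneg (A j j)]
        _ = a ^ 2 * ((∑ i, A i j ^ 2) * M ^ 2) := by ring
        _ ≤ a ^ 2 * (c ^ 2 * F ^ 2) := by gcongr
        _ = c ^ 2 * (a ^ 2 * F ^ 2) := by ring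
        _ ≤ c ^ 2 := by rw [haF]; nlinarith [sq_nonneg c])
    (by
      refine (sum_offDiagScaled_mul_self_sq_le a A).trans ?_
      rw [← hB, hsumB]
      have h5 : a ^ 2 * (F ^ 2 - d) ≤ 1 / 2 := by rw [mul_sub, haF]; linarith
      have h6 : 0 ≤ a ^ 2 * (F ^ 2 - d) := by rw [mul_sub, haF]; nlinarith
      calc 4 * a ^ 2 * spectralNormMat A ^ 2 * (a ^ 2 * (F ^ 2 - d))
          ≤ 4 * a ^ 2 * (c ^ 2 * F ^ 2) * (1 / 2) := by gcongr
        _ = 2 * c ^ 2 * (a ^ 2 * F ^ 2) := by ring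
        _ = c ^ 2 := by rw [haF]; ring) t
  -- the diagonal part
  set D : E → ℝ := fun ω => ∑ i, ∑ j, Matrix.diagonal (fun i => a * A i i) i j * (X i ω * X j ω)
    - ∑ i, Matrix.diagonal (fun i => a * A i i) i i with hD
  have hD2 := hX.integral_quadratic_sub_trace_sq Finset.univ
    (Matrix.isSymm_diagonal (fun i => a * A i i))
  have hDm : Measurable D :=
    (hX.measurable_quadratic Finset.univ (Matrix.diagonal (fun i => a * A i i))).sub_const _
  have hDL : MemLp D 2 μ :=
    (hX.memLp_quadratic Finset.univ (Matrix.diagonal (fun i => a * A i i))).sub (memLp_const _)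
  have hDsq : ∫ ω, D ω ^ 2 ∂μ ≤ c ^ 2 := by
    have e1 : ∀ i, ∑ j, Matrix.diagonal (fun i => a * A i i) i j ^ 2 = a ^ 2 * A i i ^ 2 := by
      intro i
      rw [Finset.sum_eq_single i]
      · simp [mul_pow]
      · intro j _ hj
        simp [Matrix.diagonal_apply_ne _ hj.symm]
      · simp
    rw [hD, hD2]
    simp_rw [e1, Matrix.diagonal_apply_eq, mul_sub, Finset.sum_sub_distrib, ← Finset.sum_mul,
      mul_pow, mul_assoc, ← Finset.mul_sum]
    rw [← hd]
    nlinarith [mul_le_mul_of_nonneg_left hm4 ha2']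
  have hDabs : ∫ ω, |D ω| ∂μ ≤ c := by
    have hpt : ∀ ω, |D ω| ≤ c / 2 + D ω ^ 2 / (2 * c) := by
      intro ω
      have : 0 ≤ (c - |D ω|) ^ 2 / (2 * c) := by positivity
      have e : (c - |D ω|) ^ 2 / (2 * c) = c / 2 - |D ω| + D ω ^ 2 / (2 * c) := by
        rw [← sq_abs (D ω)]; field_simp; ring
      linarith
    have hDi := hDL.integrable_sq
    refine (integral_mono (hDL.integrable (by norm_num)).abs (by fun_prop) hpt).trans ?_
    rw [integral_add (by fun_prop) (by fun_prop)]
    simp only [integral_const, probReal_univ, smul_eq_mul, one_mul]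
    rw [integral_div]
    have : (∫ ω, D ω ^ 2 ∂μ) / (2 * c) ≤ c / 2 := by
      rw [div_le_iff₀ (by positivity)]; nlinarith
    linarith
  have hdec : ∀ ω, (quadForm A (fun i => X i ω) - A.trace) / (√2 * F) =
      ∑ i, ∑ k, B i k * (X i ω * X k ω) + D ω := by
    intro ω
    have e1 : ∀ i k, A i k * (X i ω * X k ω) * a = B i k * (X i ω * X k ω) +
        Matrix.diagonal (fun i => a * A i i) i k * (X i ω * X k ω) := by
      intro i k
      by_cases h : i = k
      · subst h; simp [hB, offDiagScaled]; ring
      · simp [hB, offDiagScaled, h]; ring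
    rw [quadForm_eq_sum, div_eq_mul_inv, ← ha, sub_mul, Finset.sum_mul]
    simp_rw [Finset.sum_mul, e1, Finset.sum_add_distrib]
    simp only [hD, Matrix.trace, Matrix.diag_apply, Matrix.diagonal_apply_eq, ← Finset.mul_sum]
    ring
  simp_rw [hdec]
  have hQm := hX.measurable_quadratic Finset.univ B
  have i1 : Integrable (fun ω => Complex.exp (↑(t * ∑ i, ∑ k, B i k * (X i ω * X k ω)) *
      Complex.I)) μ := by
    simpa using integrable_ofReal_mul_exp (μ := μ) (integrable_const (1 : ℝ)) hQm t
  have i2 : Integrable (fun ω => Complex.exp (↑(t * (∑ i, ∑ k, B i k * (X i ω * X k ω) + D ω)) *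
      Complex.I)) μ := by
    simpa using integrable_ofReal_mul_exp (μ := μ) (integrable_const (1 : ℝ)) (hQm.add hDm) t
  have hdiff : ‖∫ ω, Complex.exp (↑(t * (∑ i, ∑ k, B i k * (X i ω * X k ω) + D ω)) *
      Complex.I) ∂μ - ∫ ω, Complex.exp (↑(t * ∑ i, ∑ k, B i k * (X i ω * X k ω)) *
      Complex.I) ∂μ‖ ≤ |t| * c := by
    rw [← integral_sub i2 i1]
    have hg : Integrable (fun ω => |t| * |D ω|) μ :=
      (hDL.integrable (by norm_num)).abs.const_mul _
    refine (norm_integral_le_of_norm_le hg (ae_of_all _ fun ω => ?_)).trans ?_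
    · rw [mul_add, Complex.ofReal_add, add_mul, Complex.exp_add, ← mul_sub_one, norm_mul,
        Complex.norm_exp_ofReal_mul_I, one_mul, ← abs_mul]
      exact norm_exp_ofReal_mul_I_sub_one_le _
    · rw [integral_const_mul]
      gcongr
  calc _ ≤ _ := norm_sub_le_norm_sub_add_norm_sub _ (∫ ω, Complex.exp
        (↑(t * ∑ i, ∑ k, B i k * (X i ω * X k ω)) * Complex.I) ∂μ) _
    _ ≤ |t| * c + (26 * t ^ 2 + 7 * |t|) * c * |t| := add_le_add hdiff hoff
    _ = _ := by ring

end IsStandardIndep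

/-! ### Regular conditional distributions -/

section CondDistrib

variable {Ω β 𝓨 : Type*} {mΩ : MeasurableSpace Ω} {mβ : MeasurableSpace β} {m𝓨 : MeasurableSpace 𝓨}
  [StandardBorelSpace 𝓨] [Nonempty 𝓨] {P : Measure Ω} [IsProbabilityMeasure P]
  {T : Ω → β} {Y : Ω → 𝓨}

lemma condLExp_prod_ae_eq_lintegral_condDistrib (hT : Measurable T) (hY : Measurable Y)
    {F : β × 𝓨 → ℝ≥0∞} (hF : Measurable F) :
    P⁻[fun ω => F (T ω, Y ω) | mβ.comap T] =ᵐ[P]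
      fun ω => ∫⁻ y, F (T ω, y) ∂condDistrib Y T P (T ω) := by
  have hm : Measurable fun b => ∫⁻ y, F (b, y) ∂condDistrib Y T P b :=
    hF.lintegral_kernel_prod_right'
  refine (ae_eq_condLExp hT.comap_le P _ (hm.comp (comap_measurable T)) ?_).symm
  rintro s ⟨u, hu, rfl⟩
  have h := Measure.setLIntegral_compProd (μ := P.map T) (κ := condDistrib Y T P) hF hu
    MeasurableSet.univ
  rw [compProd_map_condDistrib hY.aemeasurable, setLIntegral_map (hu.prod .univ) hF (hT.prodMk hY),
    Set.mk_preimage_prod, Set.preimage_univ, Set.inter_univ] at h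
  simp only [Measure.restrict_univ] at h
  rw [setLIntegral_map hu hm hT] at h
  exact h.symm

lemma condAbsMoment_ae_eq_lintegral_condDistrib (hT : Measurable T) (hY : Measurable Y)
    {f : β × 𝓨 → ℝ} (hf : Measurable f) :
    condAbsMoment P (mβ.comap T) (fun ω => f (T ω, Y ω)) =ᵐ[P]
      fun ω => ∫⁻ y, ‖f (T ω, y)‖ₑ ∂condDistrib Y T P (T ω) := by
  have h := condLExp_prod_ae_eq_lintegral_condDistrib (P := P) hT hY (F := fun x => ‖f x‖ₑ)
    (by fun_prop)
  simpa only [condAbsMoment, Real.enorm_eq_ofReal_abs] using h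

/-- The extended conditional expectation is an integral against the regular conditional
distribution wherever the latter integral converges. -/
lemma condExpExt_ae_eq_integral_condDistrib (hT : Measurable T) (hY : Measurable Y)
    {f : β × 𝓨 → ℝ} (hf : Measurable f) :
    ∀ᵐ ω ∂P, Integrable (fun y => f (T ω, y)) (condDistrib Y T P (T ω)) →
      condExpExt P (mβ.comap T) (fun ω => f (T ω, Y ω)) ω =
        ∫ y, f (T ω, y) ∂condDistrib Y T P (T ω) := by
  have h1 := condLExp_prod_ae_eq_lintegral_condDistrib (P := P) hT hY
    (F := fun x => ENNReal.ofReal (f x)) (by fun_prop)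
  have h2 := condLExp_prod_ae_eq_lintegral_condDistrib (P := P) hT hY
    (F := fun x => ENNReal.ofReal (-f x)) (by fun_prop)
  filter_upwards [h1, h2] with ω h1 h2 hi
  rw [condExpExt, h1, h2, integral_eq_lintegral_pos_part_sub_lintegral_neg_part hi]

end CondDistrib

section Standard

variable {Ω β ι : Type*} {mΩ : MeasurableSpace Ω} {mβ : MeasurableSpace β}
  {P : Measure Ω} [IsProbabilityMeasure P] {T : Ω → β} {Z : ι → Ω → ℝ}

/-- Factorization over the half-lines `(-∞, q]`, `q` rational, suffices for independence of the
coordinates. -/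
lemma iIndepFun_eval_of_Iic_rat {κ : Measure (ι → ℝ)} [IsProbabilityMeasure κ]
    (h : ∀ (S : Finset ι) (q : ι → ℚ),
      κ.real (⋂ i ∈ S, (fun y : ι → ℝ => y i) ⁻¹' Set.Iic (q i : ℝ)) =
        ∏ i ∈ S, κ.real ((fun y : ι → ℝ => y i) ⁻¹' Set.Iic (q i : ℝ))) :
    iIndepFun (fun (i : ι) (y : ι → ℝ) => y i) κ := by
  rw [iIndepFun_iff_iIndep]
  refine iIndepSets.iIndep (fun i => (measurable_pi_apply i).comap_le)
    (fun i => (Set.preimage fun y : ι → ℝ => y i) '' (⋃ a : ℚ, {Set.Iic (a : ℝ)}))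
    (fun i => ?_) (fun i => ?_) ?_
  · have := Real.isPiSystem_Iic_rat.comap (fun y : ι → ℝ => y i)
    convert! this using 1
  · rw [BorelSpace.measurable_eq (α := ℝ), Real.borel_eq_generateFrom_Iic_rat,
      MeasurableSpace.comap_generateFrom]
  · rw [iIndepSets_iff]
    intro S f hf
    have hq : ∀ i, ∃ q : ℚ, i ∈ S → f i = (fun y : ι → ℝ => y i) ⁻¹' Set.Iic (q : ℝ) := by
      intro i
      by_cases hi : i ∈ S
      · obtain ⟨s, hs, hsf⟩ := hf i hi
        obtain ⟨q, hq⟩ := Set.mem_iUnion.mp hs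
        exact ⟨q, fun _ => by rw [← hsf, Set.mem_singleton_iff.mp hq]⟩
      · exact ⟨0, fun h => absurd h hi⟩
    choose q hq using hq
    have e1 : ⋂ i ∈ S, f i = ⋂ i ∈ S, (fun y : ι → ℝ => y i) ⁻¹' Set.Iic (q i : ℝ) :=
      Set.iInter₂_congr hq
    have e2 : ∏ i ∈ S, κ (f i) = ∏ i ∈ S, κ ((fun y : ι → ℝ => y i) ⁻¹' Set.Iic (q i : ℝ)) :=
      Finset.prod_congr rfl fun i hi => by rw [hq i hi]
    rw [e1, e2]
    have h' := h S q
    simp only [measureReal_def] at h'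
    rw [← ENNReal.toReal_prod] at h'
    exact (ENNReal.toReal_eq_toReal_iff' (measure_ne_top _ _)
      (ENNReal.prod_ne_top fun i _ => measure_ne_top _ _)).mp h'

variable [Fintype ι]

/-- Conditionally on `T`, the coordinates are almost surely independent under the regular
conditional distribution. -/
lemma CondIndepGiven.ae_iIndepFun_condDistrib (hT : Measurable T) (hZ : ∀ i, Measurable (Z i))
    (h : CondIndepGiven P (mβ.comap T) Z) :
    ∀ᵐ ω ∂P, iIndepFun (fun (i : ι) (y : ι → ℝ) => y i)
      (condDistrib (fun ω i => Z i ω) T P (T ω)) := by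
  have hY : Measurable (fun ω i => Z i ω) := measurable_pi_lambda _ hZ
  have key : ∀ (S : Finset ι) (q : ι → ℚ), ∀ᵐ ω ∂P,
      (condDistrib (fun ω i => Z i ω) T P (T ω)).real
        (⋂ i ∈ S, (fun y : ι → ℝ => y i) ⁻¹' Set.Iic (q i : ℝ)) =
      ∏ i ∈ S, (condDistrib (fun ω i => Z i ω) T P (T ω)).real
        ((fun y : ι → ℝ => y i) ⁻¹' Set.Iic (q i : ℝ)) := by
    intro S q
    have hs : ∀ i, MeasurableSet ((fun y : ι → ℝ => y i) ⁻¹' Set.Iic (q i : ℝ)) := fun i =>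
      measurable_pi_apply i measurableSet_Iic
    have h1 := condDistrib_ae_eq_condExp (μ := P) hT hY (S.measurableSet_biInter fun i _ => hs i)
    have h2 : ∀ᵐ ω ∂P, ∀ i, _ := ae_all_iff.mpr fun i =>
      condDistrib_ae_eq_condExp (μ := P) hT hY (hs i)
    have h3 := h S (fun i => Set.Iic (q i : ℝ)) fun i _ => measurableSet_Iic
    filter_upwards [h1, h2, h3] with ω h1 h2 h3
    rw [h1, Finset.prod_congr rfl fun i _ => h2 i]
    simp only [Set.preimage_iInter, Finset.prod_apply] at h3 ⊢
    exact h3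
  have hall : ∀ᵐ ω ∂P, ∀ (S : Finset ι) (q : ι → ℚ), _ :=
    ae_all_iff.mpr fun S => ae_all_iff.mpr fun q => key S q
  filter_upwards [hall] with ω hω
  exact iIndepFun_eval_of_Iic_rat hω

/-- The conditional moment hypotheses pass to the regular conditional distribution. -/
lemma ae_isStandardIndep_condDistrib (hT : Measurable T) (hZ : ∀ i, Measurable (Z i))
    (hind : CondIndepGiven P (mβ.comap T) Z)
    (hmean : ∀ i, ∀ᵐ ω ∂P, condExpExt P (mβ.comap T) (Z i) ω = 0)
    (hvar : ∀ i, ∀ᵐ ω ∂P, condExpExt P (mβ.comap T) (fun ω' => Z i ω' ^ 2) ω = 1)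
    (hfour : ∀ i, ∀ᵐ ω ∂P, condAbsMoment P (mβ.comap T) (fun ω' => Z i ω' ^ 4) ω < ∞) :
    ∀ᵐ ω ∂P, IsStandardIndep (fun (i : ι) (y : ι → ℝ) => y i)
      (condDistrib (fun ω i => Z i ω) T P (T ω)) := by
  have hY : Measurable (fun ω i => Z i ω) := measurable_pi_lambda _ hZ
  have a1 : ∀ᵐ ω ∂P, ∀ i, _ := ae_all_iff.mpr fun i =>
    condExpExt_ae_eq_integral_condDistrib (P := P) hT hY (f := fun x => x.2 i) (by fun_prop)
  have a2 : ∀ᵐ ω ∂P, ∀ i, _ := ae_all_iff.mpr fun i =>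
    condExpExt_ae_eq_integral_condDistrib (P := P) hT hY (f := fun x => x.2 i ^ 2) (by fun_prop)
  have a4 : ∀ᵐ ω ∂P, ∀ i, _ := ae_all_iff.mpr fun i =>
    condAbsMoment_ae_eq_lintegral_condDistrib (P := P) hT hY (f := fun x => x.2 i ^ 4)
      (by fun_prop)
  filter_upwards [hind.ae_iIndepFun_condDistrib hT hZ, a1, a2, a4, ae_all_iff.mpr hmean,
    ae_all_iff.mpr hvar, ae_all_iff.mpr hfour] with ω hi a1 a2 a4 hm hv hf
  have hL : ∀ i, MemLp (fun y : ι → ℝ => y i) 4 (condDistrib (fun ω i => Z i ω) T P (T ω)) := by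
    intro i
    have hm : Measurable (fun y : ι → ℝ => y i) := measurable_pi_apply i
    have h4 := hf i
    rw [a4 i] at h4
    rw [← integrable_norm_rpow_iff hm.aestronglyMeasurable (by norm_num) (by norm_num)]
    have : Integrable (fun y : ι → ℝ => y i ^ 4)
        (condDistrib (fun ω i => Z i ω) T P (T ω)) :=
      ⟨(hm.pow_const 4).aestronglyMeasurable, h4⟩
    refine this.norm.congr (ae_of_all _ fun y => ?_)
    simp only [norm_pow]
    norm_num
  exact
    { measurable := measurable_pi_apply
      indep := hi
      memLp := hL
      integral_eq_zero := fun i => by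
        rw [← hm i, ← a1 i ((hL i).integrable (by norm_num))]
      integral_sq := fun i => by
        rw [← hv i, ← a2 i ((hL i).mono_exponent (by norm_num : (2 : ℝ≥0∞) ≤ 4)).integrable_sq] }

end Standard

/-! ### Quadratic forms with random coefficients -/

section Conditional

variable {Ω β : Type*} {mΩ : MeasurableSpace Ω} {mβ : MeasurableSpace β}
  {P : Measure Ω} [IsProbabilityMeasure P] {T : Ω → β} {n : ℕ} {Z : Fin n → Ω → ℝ}
  {A : β → Matrix (Fin n) (Fin n) ℝ}

lemma measurable_quadForm (hA : ∀ i j, Measurable fun b => A b i j) :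
    Measurable (fun x : β × (Fin n → ℝ) => quadForm (A x.1) x.2) := by
  simp_rw [quadForm_eq_sum]
  refine Finset.measurable_sum _ fun i _ => Finset.measurable_sum _ fun j _ => ?_
  have := (hA i j).comp (measurable_fst : Measurable (Prod.fst : β × (Fin n → ℝ) → β))
  exact this.mul (by fun_prop)

lemma measurable_frobeniusNormMat (hA : ∀ i j, Measurable fun b => A b i j) :
    Measurable (fun b => frobeniusNormMat (A b)) := by
  simp only [frobeniusNormMat, Matrix.trace, Matrix.diag_apply, Matrix.mul_apply,
    Matrix.transpose_apply]
  fun_prop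

/-- Under the regular conditional distribution, the quadratic form is integrable with mean the
trace of its matrix. -/
lemma ae_condExpExt_quadForm (hT : Measurable T) (hZ : ∀ i, Measurable (Z i))
    (hA : ∀ i j, Measurable fun b => A b i j)
    (hX : ∀ᵐ ω ∂P, IsStandardIndep (fun (i : Fin n) (y : Fin n → ℝ) => y i)
      (condDistrib (fun ω i => Z i ω) T P (T ω))) :
    ∀ᵐ ω ∂P,
      condAbsMoment P (mβ.comap T) (fun ω' => quadForm (A (T ω')) (fun i => Z i ω')) ω < ∞ ∧
      condExpExt P (mβ.comap T) (fun ω' => quadForm (A (T ω')) (fun i => Z i ω')) ω =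
        (A (T ω)).trace := by
  have hY : Measurable (fun ω i => Z i ω) := measurable_pi_lambda _ hZ
  filter_upwards [hX, condAbsMoment_ae_eq_lintegral_condDistrib (P := P) hT hY
    (measurable_quadForm hA), condExpExt_ae_eq_integral_condDistrib (P := P) hT hY
    (measurable_quadForm hA)] with ω hX h1 h2
  have hi : Integrable (fun y => quadForm (A (T ω)) y)
      (condDistrib (fun ω i => Z i ω) T P (T ω)) := by
    simp_rw [quadForm_eq_sum]
    exact (hX.memLp_quadratic Finset.univ _).integrable (by norm_num)
  refine ⟨by rw [h1]; exact hi.2, ?_⟩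
  rw [h2 hi]
  simp_rw [quadForm_eq_sum]
  exact hX.integral_quadratic Finset.univ _

/-- Conditioning on the coefficients: the characteristic function of the normalized quadratic form
is close to the Gaussian one, up to the probability that one of the three ratios is not small. -/
theorem enorm_integral_exp_quadForm_sub_le (hT : Measurable T) (hZ : ∀ i, Measurable (Z i))
    (hA : ∀ i j, Measurable fun b => A b i j) (hAs : ∀ b, (A b).IsSymm) (hA0 : ∀ b, A b ≠ 0)
    (hX : ∀ᵐ ω ∂P, IsStandardIndep (fun (i : Fin n) (y : Fin n → ℝ) => y i)
      (condDistrib (fun ω i => Z i ω) T P (T ω)))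
    {m : Fin n → Ω → ℝ}
    (hm : ∀ j, m j = condExpExt P (mβ.comap T) (fun ω' => Z j ω' ^ 4))
    {c : ℝ} (hc0 : 0 < c) (hc1 : c ≤ 1) (t : ℝ) :
    ‖∫ ω, Complex.exp (↑(t * ((quadForm (A (T ω)) (fun i => Z i ω) - (A (T ω)).trace) /
          (√2 * frobeniusNormMat (A (T ω))))) * Complex.I) ∂P - Complex.exp (-t ^ 2 / 2)‖ₑ ≤
      ENNReal.ofReal (((26 * t ^ 2 + 7 * |t|) * |t| + |t|) * c) +
      2 * (P {ω | c ^ 2 < spectralNormMat (A (T ω)) ^ 2 / frobeniusNormMat (A (T ω)) ^ 2 *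
              ⨆ j, m j ω} +
          P {ω | c ^ 2 < (⨆ j, (A (T ω) ^ 2) j j) / frobeniusNormMat (A (T ω)) ^ 2 *
              (⨆ j, m j ω) ^ 2} +
          P {ω | c ^ 2 < ∑ j, A (T ω) j j ^ 2 * m j ω / frobeniusNormMat (A (T ω)) ^ 2}) := by
  have hY : Measurable (fun ω i => Z i ω) := measurable_pi_lambda _ hZ
  set κ := condDistrib (fun ω i => Z i ω) T P with hκ
  set f : β × (Fin n → ℝ) → ℂ := fun x => Complex.exp (↑(t * ((quadForm (A x.1) x.2 -
    (A x.1).trace) / (√2 * frobeniusNormMat (A x.1)))) * Complex.I) with hf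
  have htr : Measurable fun b => (A b).trace := by
    simp only [Matrix.trace, Matrix.diag_apply]
    fun_prop
  have hfm : Measurable f := by
    have h1 := measurable_quadForm hA
    have h2 := htr.comp (measurable_fst : Measurable (Prod.fst : β × (Fin n → ℝ) → β))
    have h3 := (measurable_frobeniusNormMat hA).comp
      (measurable_fst : Measurable (Prod.fst : β × (Fin n → ℝ) → β))
    have h4 : Measurable fun x : β × (Fin n → ℝ) => t * ((quadForm (A x.1) x.2 -
        (A x.1).trace) / (√2 * frobeniusNormMat (A x.1))) :=
      ((h1.sub h2).div (h3.const_mul _)).const_mul t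
    fun_prop
  have hfn : ∀ x, ‖f x‖ = 1 := fun x => Complex.norm_exp_ofReal_mul_I _
  have hfi : Integrable (fun ω => f (T ω, fun i => Z i ω)) P :=
    (integrable_const (1 : ℝ)).mono' (hfm.comp (hT.prodMk hY)).aestronglyMeasurable
      (ae_of_all _ fun ω => (hfn _).le)
  have hcond := condExp_prod_ae_eq_integral_condDistrib (μ := P) hT hY.aemeasurable
    hfm.stronglyMeasurable hfi
  have hint : ∫ ω, f (T ω, fun i => Z i ω) ∂P = ∫ ω, ∫ y, f (T ω, y) ∂κ (T ω) ∂P := by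
    rw [← integral_condExp hT.comap_le]
    exact integral_congr_ae hcond
  have hφi : Integrable (fun ω => ∫ y, f (T ω, y) ∂κ (T ω)) P :=
    integrable_condExp.congr hcond
  have hm4 : ∀ᵐ ω ∂P, ∀ j, m j ω = ∫ y, y j ^ 4 ∂κ (T ω) := by
    have : ∀ᵐ ω ∂P, ∀ i, _ := ae_all_iff.mpr fun i =>
      condExpExt_ae_eq_integral_condDistrib (P := P) hT hY (f := fun x => x.2 i ^ 4) (by fun_prop)
    filter_upwards [this, hX] with ω h1 hX j
    rw [hm j]
    exact h1 j (hX.memLp j).integrable_pow_four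
  set K := ((26 * t ^ 2 + 7 * |t|) * |t| + |t|) * c with hK
  set B₁ := {ω | c ^ 2 < spectralNormMat (A (T ω)) ^ 2 / frobeniusNormMat (A (T ω)) ^ 2 *
    ⨆ j, m j ω} with hB₁
  set B₂ := {ω | c ^ 2 < (⨆ j, (A (T ω) ^ 2) j j) / frobeniusNormMat (A (T ω)) ^ 2 *
    (⨆ j, m j ω) ^ 2} with hB₂
  set B₃ := {ω | c ^ 2 < ∑ j, A (T ω) j j ^ 2 * m j ω / frobeniusNormMat (A (T ω)) ^ 2} with hB₃
  -- the exceptional set need not be measurable, so it is replaced by a measurable hull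
  set B := toMeasurable P (B₁ ∪ B₂ ∪ B₃) with hB
  have hpt : ∀ᵐ ω ∂P, ‖∫ y, f (T ω, y) ∂κ (T ω) - Complex.exp (-t ^ 2 / 2)‖ₑ ≤
      ENNReal.ofReal K + B.indicator (fun _ => 2) ω := by
    filter_upwards [hX, hm4] with ω hX hm4
    by_cases hω : ω ∈ B₁ ∪ B₂ ∪ B₃
    · rw [Set.indicator_of_mem (subset_toMeasurable P _ hω)]
      refine le_trans ?_ le_add_self
      have h1 : ‖∫ y, f (T ω, y) ∂κ (T ω)‖ ≤ 1 := by
        refine (norm_integral_le_of_norm_le_const (C := 1)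
          (ae_of_all _ fun y => (hfn _).le)).trans ?_
        simp
      have h2 : ‖Complex.exp (-(t : ℂ) ^ 2 / 2)‖ ≤ 1 := by
        have : -(t : ℂ) ^ 2 / 2 = ((-t ^ 2 / 2 : ℝ) : ℂ) := by push_cast; rfl
        rw [this, Complex.norm_exp, Complex.ofReal_re, Real.exp_le_one_iff]
        nlinarith [sq_nonneg t]
      rw [← ofReal_norm]
      refine ENNReal.ofReal_le_of_le_toReal ?_
      refine (norm_sub_le _ _).trans ?_
      norm_num
      linarith
    · refine le_trans ?_ le_self_add
      rw [← ofReal_norm]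
      refine ENNReal.ofReal_le_ofReal ?_
      simp only [hB₁, hB₂, hB₃, Set.mem_union, Set.mem_ofPred_eq, not_or, not_lt, hm4] at hω
      exact hX.norm_integral_exp_quadForm_sub_le (hAs _) (hA0 _) hc0 hc1 hω.1.1 hω.1.2 hω.2 t
  change ‖∫ ω, f (T ω, fun i => Z i ω) ∂P - _‖ₑ ≤ _
  have hconst : Complex.exp (-(t : ℂ) ^ 2 / 2) = ∫ _, Complex.exp (-(t : ℂ) ^ 2 / 2) ∂P := by simp
  rw [hint, hconst, ← integral_sub hφi (integrable_const _)]
  refine (enorm_integral_le_lintegral_enorm _).trans ((lintegral_mono_ae hpt).trans ?_)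
  rw [lintegral_add_left measurable_const, lintegral_indicator (measurableSet_toMeasurable _ _)]
  simp only [lintegral_const, measure_univ, mul_one, Measure.restrict_apply, MeasurableSet.univ,
    Set.univ_inter]
  rw [measure_toMeasurable]
  gcongr
  exact (measure_union_le _ _).trans (add_le_add_left (measure_union_le _ _) _)

end Conditional

/-! ### Convergence in distribution -/

lemma tendsto_measure_lt_of_tendstoInMeasure {Ω : Type*} {mΩ : MeasurableSpace Ω} {P : Measure Ω}
    {X : ℕ → Ω → ℝ} (h : TendstoInMeasure P X atTop fun _ => 0) {ε : ℝ} (hε : 0 < ε) :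
    Tendsto (fun n => P {ω | ε < X n ω}) atTop (nhds 0) := by
  refine tendsto_of_tendsto_of_tendsto_of_le_of_le tendsto_const_nhds
    (h (ENNReal.ofReal ε) (by simpa using hε)) (fun _ => zero_le)
    fun n => measure_mono fun ω hω => ?_
  simp only [Set.mem_ofPred_eq] at hω ⊢
  rw [edist_zero_right, Real.enorm_eq_ofReal_abs]
  exact ENNReal.ofReal_le_ofReal (hω.le.trans (le_abs_self _))

lemma tendstoInDistribution_gaussian_of_tendsto_integral_exp {Ω : Type*} {mΩ : MeasurableSpace Ω}
    {P : Measure Ω} [IsProbabilityMeasure P] {X : ℕ → Ω → ℝ} (hX : ∀ n, AEMeasurable (X n) P)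
    (h : ∀ t : ℝ, Tendsto (fun n => ∫ ω, Complex.exp (↑(t * X n ω) * Complex.I) ∂P) atTop
      (nhds (Complex.exp (-t ^ 2 / 2)))) :
    TendstoInDistribution X atTop (id : ℝ → ℝ) (fun _ => P) (gaussianReal 0 1) where
  forall_aemeasurable := hX
  aemeasurable_limit := aemeasurable_id
  tendsto := by
    refine ProbabilityMeasure.tendsto_iff_tendsto_charFun.2 fun t => ?_
    have e : ∀ n, charFun (P.map (X n)) t = ∫ ω, Complex.exp (↑(t * X n ω) * Complex.I) ∂P := by
      intro n
      rw [charFun_apply_real, integral_map (hX n) (by fun_prop)]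
      push_cast
      rfl
    simpa [e, charFun_gaussianReal, neg_div] using h t

theorem mainTheorem6 {Ω : Type*} {mΩ : MeasurableSpace Ω} (P : Measure Ω) [IsProbabilityMeasure P]
    (G : ℕ → MeasurableSpace Ω)
    (A : (n : ℕ) → Ω → Matrix (Fin n) (Fin n) ℝ)
    (Z : (n : ℕ) → Fin n → Ω → ℝ)
    (hG : ∀ n, 1 ≤ n → G n ≤ mΩ)
    (hA_meas : ∀ n, 1 ≤ n → ∀ i j, Measurable[G n] (fun ω => A n ω i j))
    (hA_symm : ∀ n, 1 ≤ n → ∀ ω, (A n ω).IsSymm)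
    (hA_ne : ∀ n, 1 ≤ n → ∀ ω, A n ω ≠ 0)
    (hZ_meas : ∀ n, 1 ≤ n → ∀ i, Measurable[mΩ] (Z n i))
    (hZ_indep : ∀ n, 1 ≤ n → CondIndepGiven P (G n) (Z n))
    (hZ_mean : ∀ n, 1 ≤ n → ∀ i, ∀ᵐ ω ∂P, condExpExt P (G n) (Z n i) ω = 0)
    (hZ_var : ∀ n, 1 ≤ n → ∀ i, ∀ᵐ ω ∂P, condExpExt P (G n) (fun ω' => Z n i ω' ^ 2) ω = 1)
    (hZ_four : ∀ n, 1 ≤ n → ∀ i, ∀ᵐ ω ∂P, condAbsMoment P (G n) (fun ω' => Z n i ω' ^ 4) ω < ∞)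
    (h_spectral : TendstoInMeasure P
      (fun n ω => spectralNormMat (A n ω) ^ 2 / frobeniusNormMat (A n ω) ^ 2 *
        ⨆ j, condExpExt P (G n) (fun ω' => Z n j ω' ^ 4) ω)
      atTop (fun _ => 0))
    (h_rows : TendstoInMeasure P
      (fun n ω => (⨆ j, (A n ω ^ 2) j j) / frobeniusNormMat (A n ω) ^ 2 *
        (⨆ j, condExpExt P (G n) (fun ω' => Z n j ω' ^ 4) ω) ^ 2)
      atTop (fun _ => 0))
    (h_diag : TendstoInMeasure P
      (fun n ω => ∑ j, A n ω j j ^ 2 * condExpExt P (G n) (fun ω' => Z n j ω' ^ 4) ω /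
        frobeniusNormMat (A n ω) ^ 2)
      atTop (fun _ => 0)) :
    (∀ n, 1 ≤ n → ∀ᵐ ω ∂P,
      condAbsMoment P (G n) (fun ω' => quadForm (A n ω') (fun i => Z n i ω')) ω < ∞) ∧
    TendstoInDistribution
      (fun n ω => (quadForm (A n ω) (fun i => Z n i ω) -
          condExpExt P (G n) (fun ω' => quadForm (A n ω') (fun i => Z n i ω')) ω) /
        (√2 * frobeniusNormMat (A n ω)))
      atTop (id : ℝ → ℝ) (fun _ => P) (gaussianReal 0 1) := by
  -- The conditioning variable is the identity, from `mΩ` to the coarser `G n`.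
  have hT : ∀ n, 1 ≤ n → Measurable[mΩ, G n] (id : Ω → Ω) := fun n hn => measurable_id'' (hG n hn)
  have hcomap : ∀ n, (G n).comap (id : Ω → Ω) = G n := fun n => MeasurableSpace.comap_id
  have hX := fun n (hn : 1 ≤ n) => ae_isStandardIndep_condDistrib (mβ := G n) (P := P) (hT n hn)
    (hZ_meas n hn) (by rw [hcomap]; exact hZ_indep n hn) (by rw [hcomap]; exact hZ_mean n hn)
    (by rw [hcomap]; exact hZ_var n hn) (by rw [hcomap]; exact hZ_four n hn)
  have hE := fun n (hn : 1 ≤ n) => ae_condExpExt_quadForm (mβ := G n) (P := P) (hT n hn)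
    (hZ_meas n hn) (hA_meas n hn) (hX n hn)
  simp only [hcomap, id] at hE
  have hq : ∀ n, 1 ≤ n → Measurable fun ω => quadForm (A n ω) (fun i => Z n i ω) := fun n hn =>
    (measurable_quadForm (mβ := G n) (hA_meas n hn)).comp
      ((hT n hn).prodMk (measurable_pi_lambda _ (hZ_meas n hn)))
  refine ⟨fun n hn => (hE n hn).mono fun ω h => h.1,
    tendstoInDistribution_gaussian_of_tendsto_integral_exp (fun n => ?_) fun t => ?_⟩
  · rcases Nat.eq_zero_or_pos n with rfl | hn
    · -- For `n = 0` the denominator vanishes.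
      have : ∀ ω, frobeniusNormMat (A 0 ω) = 0 := fun ω => by simp [frobeniusNormMat]
      simp [this]
    · have h1 : Measurable[mΩ] fun ω => frobeniusNormMat (A n ω) :=
        (measurable_frobeniusNormMat (mβ := G n) (hA_meas n hn)).mono (hG n hn) le_rfl
      have h2 : Measurable[mΩ]
          (condExpExt P (G n) fun ω' => quadForm (A n ω') (fun i => Z n i ω')) :=
        (measurable_condLExp' _ _ _).ennreal_toReal.sub (measurable_condLExp' _ _ _).ennreal_toReal
      exact (((hq n hn).sub h2).div (h1.const_mul _)).aemeasurable
  · set K := (26 * t ^ 2 + 7 * |t|) * |t| + |t| with hK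
    have hK0 : 0 ≤ K := by positivity
    rw [tendsto_iff_edist_tendsto_0, ENNReal.tendsto_nhds_zero]
    intro ε hε
    -- `c` makes the deterministic error at most `ε / 2`
    obtain ⟨c, hc0, hc1, hc⟩ : ∃ c : ℝ, 0 < c ∧ c ≤ 1 ∧ ENNReal.ofReal (K * c) ≤ ε / 2 := by
      have hlim : Tendsto (fun c : ℝ => ENNReal.ofReal (K * c)) (nhdsWithin 0 (Set.Ioi 0))
          (nhds 0) := by
        have : Tendsto (fun c : ℝ => ENNReal.ofReal (K * c)) (nhds 0)
            (nhds (ENNReal.ofReal (K * 0))) :=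
          (ENNReal.continuous_ofReal.comp (continuous_const_mul K)).tendsto 0
        rw [mul_zero, ENNReal.ofReal_zero] at this
        exact this.mono_left nhdsWithin_le_nhds
      have h1 := hlim.eventually (ge_mem_nhds (ENNReal.half_pos hε.ne'))
      have h2 : ∀ᶠ c : ℝ in nhdsWithin 0 (Set.Ioi 0), c ∈ Set.Ioc (0 : ℝ) 1 :=
        Ioc_mem_nhdsGT one_pos
      obtain ⟨c, hc, hc'⟩ := (h1.and h2).exists
      exact ⟨c, hc'.1, hc'.2, hc⟩
    have hc2 : 0 < c ^ 2 := by positivity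
    have hlim := ((tendsto_measure_lt_of_tendstoInMeasure h_spectral hc2).add
      (tendsto_measure_lt_of_tendstoInMeasure h_rows hc2)).add
      (tendsto_measure_lt_of_tendstoInMeasure h_diag hc2)
    have hlim2 := ENNReal.Tendsto.const_mul hlim (Or.inr (by simp : (2 : ℝ≥0∞) ≠ ∞))
    rw [add_zero, add_zero, mul_zero] at hlim2
    filter_upwards [hlim2.eventually (ge_mem_nhds (ENNReal.half_pos hε.ne')),
      eventually_ge_atTop 1] with n hn hn1
    have hmain := enorm_integral_exp_quadForm_sub_le (mβ := G n) (P := P) (hT n hn1)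
      (hZ_meas n hn1) (hA_meas n hn1) (hA_symm n hn1) (hA_ne n hn1) (hX n hn1)
      (fun j => by rw [hcomap]) hc0 hc1 t
    simp only [id] at hmain
    rw [edist_eq_enorm_sub]
    have hcongr : ∫ ω, Complex.exp (↑(t * ((quadForm (A n ω) (fun i => Z n i ω) -
          condExpExt P (G n) (fun ω' => quadForm (A n ω') (fun i => Z n i ω')) ω) /
        (√2 * frobeniusNormMat (A n ω)))) * Complex.I) ∂P =
        ∫ ω, Complex.exp (↑(t * ((quadForm (A n ω) (fun i => Z n i ω) - (A n ω).trace) /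
          (√2 * frobeniusNormMat (A n ω)))) * Complex.I) ∂P :=
      integral_congr_ae ((hE n hn1).mono fun ω h => by simp only [h.2])
    rw [hcongr]
    exact (hmain.trans (add_le_add hc hn)).trans_eq (ENNReal.add_halves ε)
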